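/- Let $\alpha,\beta,v\in\mathbb{R}$ satisfy $|\alpha-\beta|<|v|<\alpha+\beta+2$ (so $\alpha,\beta>-1$ and $v\neq 0$), and let $W$ be the $2\times2$ Jacobi-type weight on $(-1,1)$ $$W(x)=(1-x)^{\alpha}(1+x)^{\beta}\left(W_2\tfrac{(1-x)^2}{4}+W_1\tfrac{1-x}{2}+W_0\right),$$ $$W_2=\begin{pmatrix}\frac{v(v+2+\alpha+\beta)}{v+\alpha-\beta}&0\\0&\frac{v(-v+2+\alpha+\beta)}{v-\alpha+\beta}\end{pmatrix},\quad W_1=\begin{pmatrix}-(v+\alpha+\beta+2)&\alpha+\beta+2\\ \alpha+\beta+2&-(-v+\alpha+\beta+2)\end{pmatrix},\quad W_0=\begin{pmatrix}\alpha+1&-\alpha-1\\-\alpha-1&\alpha+1\end{pmatrix}.$$ Differential operators $D=\sum_{i=0}^m\partial^iF_i(x)$ with $F_i\in\operatorname{Mat}_2(\mathbb{C}[x])$ act on the right on $P\in\operatorname{Mat}_2(\mathbb{C}[x])$ by $P\cdot D=\sum_i P^{(i)}F_i$, and $P\cdot(DE)=(P\cdot D)\cdot E$. Let $\mathcal{D}(W)$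 be the algebra of all such $D$ for which the matrix orthogonal polynomials $P_n$ of $W$ (that is, $\deg P_n=n$ with nonsingular leading coefficient, and $\int_{-1}^1P_nWP_m^*\,dx=0$ for $n\ne m$) satisfy $P_n\cdot D=\Lambda_nP_n$ for some $\Lambda_n\in\operatorname{Mat}_2(\mathbb{C})$, for all $n\ge0$; this does not depend on the choice of the sequence $(P_n)$. Let $\mathcal{Z}(W)$ be the center of $\mathcal{D}(W)$. Put $$\mathcal{V}=\partial\begin{pmatrix}x+\frac{\beta-\alpha}{v}&1+\frac{\beta-\alpha}{v}\\1+\frac{\alpha-\beta}{v}&x+\frac{\alpha-\beta}{v}\end{pmatrix}+\begin{pmatrix}\frac{v+2+\alpha+\beta}{2}&0\\0&\frac{-v+2+\alpha+\beta}{2}\end{pmatrix},$$ $$\mathcal{N}=\partial\begin{pmatrix}-x+\frac{\beta-\alpha}{v}&1+\frac{\beta-\alpha}{v}\\1+\frac{\alpha-\beta}{v}&-x+\frac{\alpha-\beta}{v}\end{pmatrix}-\begin{pmatrix}\frac{-v+4+\alpha+\beta}{2}&0\\0&\frac{\alpha+\beta+v+4}{2}\end{pmatrix},$$ and, with $E_{ij}$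 the matrix units, $D_1=\mathcal{N}E_{11}\mathcal{V}$, $D_2=\mathcal{N}E_{12}\mathcal{V}$, $D_3=\mathcal{N}E_{21}\mathcal{V}$, $D_4=\mathcal{N}E_{22}\mathcal{V}$, $D_5=D_1+D_4$. **Theorem.** The nine operators $I,\ D_j,\ D_5D_j$ $(j=1,2,3,4)$ belong to $\mathcal{D}(W)$ and generate $\mathcal{D}(W)$ as a module over its center $\mathcal{Z}(W)$. -/

import Mathlib

open Polynomial

/-- `Mat_N(ℂ[x])`, seen as polynomials in `x` with coefficients in `Mat_N(ℂ)`. -/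
abbrev MatPoly (N : ℕ) : Type := (Matrix (Fin N) (Fin N) ℂ)[X]

/-- Operators on `Mat_N(ℂ[x])` written on the right: `P · D` is `D.unop P`, and the product `D * E`
is "first `D`, then `E`", i.e. `P · (D * E) = (P · D) · E`. -/
abbrev RightOp (N : ℕ) : Type := (Module.End ℂ (MatPoly N))ᵐᵒᵖ

/-- The value `P · D`. -/
noncomputable def RightOp.act {N : ℕ} (P : MatPoly N) (D : RightOp N) : MatPoly N := D.unop P

/-- The operator `∂ⁱ F`, acting on the right by `P · (∂ⁱ F) = P⁽ⁱ⁾ F`. -/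
noncomputable def dTerm {N : ℕ} (i : ℕ) (F : MatPoly N) : RightOp N :=
  MulOpposite.op
    { toFun := fun P => derivative^[i] P * F
      map_add' := fun P Q => by rw [iterate_map_add, add_mul]
      map_smul' := fun c P => by
        rw [Polynomial.iterate_derivative_smul, RingHom.id_apply, smul_mul_assoc] }

/-- `D` is a matrix differential operator `∑_{i ≤ m} ∂ⁱ F_i` with polynomial coefficients. -/
def IsMatDiffOp {N : ℕ} (D : RightOp N) : Prop :=
  ∃ (m : ℕ) (F : ℕ → MatPoly N), D = ∑ i ∈ Finset.range (m + 1), dTerm i (F i)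

lemma dTerm_act {N : ℕ} (i : ℕ) (F P : MatPoly N) :
    RightOp.act P (dTerm i F) = derivative^[i] P * F := rfl

lemma rightOp_ext {N : ℕ} {D E : RightOp N} (h : ∀ P, RightOp.act P D = RightOp.act P E) :
    D = E := MulOpposite.unop_injective (LinearMap.ext h)

lemma act_mul {N : ℕ} (D E : RightOp N) (P : MatPoly N) :
    RightOp.act P (D * E) = RightOp.act (RightOp.act P D) E := rfl

lemma act_add {N : ℕ} (D E : RightOp N) (P : MatPoly N) :
    RightOp.act P (D + E) = RightOp.act P D + RightOp.act P E := rfl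

lemma add_act {N : ℕ} (D : RightOp N) (P Q : MatPoly N) :
    RightOp.act (P + Q) D = RightOp.act P D + RightOp.act Q D := map_add D.unop P Q

lemma act_sum {N : ℕ} {ι : Type} (s : Finset ι) (D : ι → RightOp N) (P : MatPoly N) :
    RightOp.act P (∑ i ∈ s, D i) = ∑ i ∈ s, RightOp.act P (D i) := by
  rw [RightOp.act, Finset.unop_sum, LinearMap.sum_apply]; rfl

lemma dTerm_add {N : ℕ} (i : ℕ) (F G : MatPoly N) :
    dTerm i (F + G) = dTerm i F + dTerm i G :=
  rightOp_ext fun P => by simp only [act_add, dTerm_act, mul_add]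

lemma dTerm_zero {N : ℕ} (i : ℕ) : dTerm i (0 : MatPoly N) = 0 :=
  rightOp_ext fun P => by rw [dTerm_act, mul_zero]; rfl

lemma dTerm_isMatDiffOp {N : ℕ} (i : ℕ) (F : MatPoly N) : IsMatDiffOp (dTerm i F) := by
  refine ⟨i, fun k => if k = i then F else 0, ?_⟩
  rw [Finset.sum_eq_single i]
  · simp
  · intro k _ hk; simp [hk, dTerm_zero]
  · intro h; simp at h

lemma IsMatDiffOp.add {N : ℕ} {D E : RightOp N} (hD : IsMatDiffOp D) (hE : IsMatDiffOp E) :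
    IsMatDiffOp (D + E) := by
  have pad : ∀ {m n : ℕ} (F : ℕ → MatPoly N), m ≤ n →
      ∑ i ∈ Finset.range (m + 1), dTerm i (F i)
        = ∑ i ∈ Finset.range (n + 1), dTerm i (if i < m + 1 then F i else 0) := by
    intro m n F hmn
    rw [← Finset.sum_subset (Finset.range_mono (Nat.succ_le_succ hmn))]
    · exact Finset.sum_congr rfl fun i hi => by rw [if_pos (Finset.mem_range.1 hi)]
    · intro i _ hi
      rw [if_neg (fun h => hi (Finset.mem_range.2 h)), dTerm_zero]
  obtain ⟨m, F, rfl⟩ := hD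
  obtain ⟨n, G, rfl⟩ := hE
  rw [pad F (le_max_left m n), pad G (le_max_right m n), ← Finset.sum_add_distrib]
  exact ⟨max m n, _, Finset.sum_congr rfl fun i _ => (dTerm_add i _ _).symm⟩

lemma IsMatDiffOp.zero {N : ℕ} : IsMatDiffOp (0 : RightOp N) :=
  dTerm_zero (N := N) 0 ▸ dTerm_isMatDiffOp 0 0

lemma IsMatDiffOp.sum {N : ℕ} {ι : Type} (s : Finset ι) (D : ι → RightOp N)
    (h : ∀ i ∈ s, IsMatDiffOp (D i)) : IsMatDiffOp (∑ i ∈ s, D i) :=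
  Finset.sum_induction D IsMatDiffOp (fun _ _ => IsMatDiffOp.add) IsMatDiffOp.zero h

/-- Composition with `∂ʲ G` on the right keeps differential operators (Leibniz rule). -/
lemma IsMatDiffOp.mul_dTerm {N : ℕ} (j : ℕ) : ∀ {D : RightOp N} (_ : IsMatDiffOp D)
    (G : MatPoly N), IsMatDiffOp (D * dTerm j G) := by
  induction j with
  | zero =>
    rintro D ⟨m, F, rfl⟩ G
    refine ⟨m, fun i => F i * G, rightOp_ext fun P => ?_⟩
    rw [act_mul, dTerm_act, act_sum, act_sum, Function.iterate_zero, id, Finset.sum_mul]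
    exact Finset.sum_congr rfl fun i _ => by rw [dTerm_act, dTerm_act, mul_assoc]
  | succ j ih =>
    rintro D ⟨m, F, rfl⟩ G
    have h : (∑ i ∈ Finset.range (m + 1), dTerm i (F i)) * dTerm (j + 1) G =
        (∑ i ∈ Finset.range (m + 1), (dTerm (i + 1) (F i) + dTerm i (derivative (F i))))
          * dTerm j G := by
      refine rightOp_ext fun P => ?_
      rw [act_mul, act_mul, dTerm_act, dTerm_act, Function.iterate_succ_apply, act_sum, act_sum,
        Polynomial.derivative_sum]
      congr 2
      refine Finset.sum_congr rfl fun i _ => ?_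
      rw [act_add, dTerm_act, dTerm_act, dTerm_act, Polynomial.derivative_mul,
        Function.iterate_succ_apply']
    rw [h]
    exact ih (IsMatDiffOp.sum _ _ fun i _ =>
      (dTerm_isMatDiffOp _ _).add (dTerm_isMatDiffOp _ _)) G

lemma IsMatDiffOp.mul {N : ℕ} {D E : RightOp N} (hD : IsMatDiffOp D) (hE : IsMatDiffOp E) :
    IsMatDiffOp (D * E) := by
  obtain ⟨m, F, rfl⟩ := hE
  rw [Finset.mul_sum]
  exact IsMatDiffOp.sum _ _ fun i _ => hD.mul_dTerm i (F i)

lemma algebraMap_eq_dTerm {N : ℕ} (c : ℂ) :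
    algebraMap ℂ (RightOp N) c = dTerm 0 (algebraMap ℂ (MatPoly N) c) :=
  rightOp_ext fun P => by
    rw [dTerm_act, Function.iterate_zero, id, ← Algebra.commutes, ← Algebra.smul_def]; rfl

/-- Differential operators commute with multiplication by constant matrices on the left. -/
lemma IsMatDiffOp.act_C_mul {N : ℕ} {D : RightOp N} (hD : IsMatDiffOp D)
    (A : Matrix (Fin N) (Fin N) ℂ) (P : MatPoly N) :
    RightOp.act (C A * P) D = C A * RightOp.act P D := by
  obtain ⟨m, F, rfl⟩ := hD
  simp only [act_sum, dTerm_act, Finset.mul_sum, Polynomial.iterate_derivative_C_mul, mul_assoc]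

/-- The form `⟨P, Q⟩_W = ∫_I P(x) W(x) Q(x)^* dx`, with the integral taken entry by entry. -/
noncomputable def weightForm {N : ℕ} (I : Set ℝ) (W : ℝ → Matrix (Fin N) (Fin N) ℂ)
    (P Q : MatPoly N) : Matrix (Fin N) (Fin N) ℂ :=
  Matrix.of fun i j => ∫ x in I,
    (P.eval (Matrix.scalar (Fin N) (x : ℂ)) * W x *
      (Q.eval (Matrix.scalar (Fin N) (x : ℂ))).conjTranspose) i j

/-- A sequence of matrix-valued orthogonal polynomials for `W` on `I`: `P n` has degree `n` with
nonsingular leading coefficient, and distinct members are orthogonal. -/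
def IsOrthogonalSeq {N : ℕ} (I : Set ℝ) (W : ℝ → Matrix (Fin N) (Fin N) ℂ)
    (P : ℕ → MatPoly N) : Prop :=
  (∀ n, (P n).natDegree = n ∧ IsUnit (P n).leadingCoeff) ∧
    ∀ n m, n ≠ m → weightForm I W (P n) (P m) = 0

/-- The algebra `𝒟(W)`: matrix differential operators with polynomial coefficients that have the
orthogonal polynomials of `W` as eigenfunctions, `P_n · D = Λ_n P_n` with `Λ_n ∈ Mat_N(ℂ)`
(for any sequence of orthogonal polynomials). -/
noncomputable def diffAlg {N : ℕ} (I : Set ℝ) (W : ℝ → Matrix (Fin N) (Fin N) ℂ) :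
    Subalgebra ℂ (RightOp N) where
  carrier := {D | IsMatDiffOp D ∧ ∀ P : ℕ → MatPoly N, IsOrthogonalSeq I W P →
    ∀ n, ∃ L : Matrix (Fin N) (Fin N) ℂ, RightOp.act (P n) D = C L * P n}
  mul_mem' := by
    rintro D E ⟨hD, hD'⟩ ⟨hE, hE'⟩
    refine ⟨hD.mul hE, fun P hP n => ?_⟩
    obtain ⟨L, hL⟩ := hD' P hP n
    obtain ⟨M, hM⟩ := hE' P hP n
    exact ⟨L * M, by rw [act_mul, hL, hE.act_C_mul, hM, C_mul, mul_assoc]⟩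
  add_mem' := by
    rintro D E ⟨hD, hD'⟩ ⟨hE, hE'⟩
    refine ⟨hD.add hE, fun P hP n => ?_⟩
    obtain ⟨L, hL⟩ := hD' P hP n
    obtain ⟨M, hM⟩ := hE' P hP n
    exact ⟨L + M, by rw [act_add, hL, hM, C_add, add_mul]⟩
  algebraMap_mem' := by
    intro c
    rw [algebraMap_eq_dTerm]
    refine ⟨dTerm_isMatDiffOp _ _, fun P _ n => ⟨algebraMap ℂ _ c, ?_⟩⟩
    rw [dTerm_act, Function.iterate_zero, id, ← Algebra.commutes]; rfl

/-- The Jacobi-type weight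
`W(x) = (1-x)^α (1+x)^β (W₂ (1-x)²/4 + W₁ (1-x)/2 + W₀)`, considered on `(-1, 1)`. -/
noncomputable def jacobiWeight (α β v : ℝ) (x : ℝ) : Matrix (Fin 2) (Fin 2) ℂ :=
  (((1 - x) ^ α * (1 + x) ^ β) •
    (((1 - x) ^ 2 / 4) •
        !![v * (v + 2 + α + β) / (v + α - β), 0;
           0, v * (-v + 2 + α + β) / (v - α + β)]
      + ((1 - x) / 2) •
        !![-(v + α + β + 2), α + β + 2;
           α + β + 2, -(-v + α + β + 2)]
      + !![α + 1, -α - 1;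
           -α - 1, α + 1])).map Complex.ofReal

/-- The algebra `𝒟(W)` of the Jacobi-type weight. -/
noncomputable abbrev jacobiAlg (α β v : ℝ) : Subalgebra ℂ (RightOp 2) :=
  diffAlg (Set.Ioo (-1) 1) (jacobiWeight α β v)

/-- A real constant matrix as a polynomial. -/
noncomputable def constMat (A : Matrix (Fin 2) (Fin 2) ℝ) : MatPoly 2 := C (A.map Complex.ofReal)

/-- The operator `𝒱 = ∂ (x + B) + A₀`. -/
noncomputable def opV (α β v : ℝ) : RightOp 2 :=
  dTerm 1 (X + constMat !![(β - α) / v, 1 + (β - α) / v; 1 + (α - β) / v, (α - β) / v])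
    + dTerm 0 (constMat !![(v + 2 + α + β) / 2, 0; 0, (-v + 2 + α + β) / 2])

/-- The operator `𝒩 = ∂ (-x + B) + C₀`. -/
noncomputable def opN (α β v : ℝ) : RightOp 2 :=
  dTerm 1 (-X + constMat !![(β - α) / v, 1 + (β - α) / v; 1 + (α - β) / v, (α - β) / v])
    + dTerm 0 (constMat !![-(-v + 4 + α + β) / 2, 0; 0, -(α + β + v + 4) / 2])

/-- `D₁ = 𝒩 E₁₁ 𝒱`. -/
noncomputable def opD1 (α β v : ℝ) : RightOp 2 :=
  opN α β v * dTerm 0 (constMat !![1, 0; 0, 0]) * opV α β v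

/-- `D₂ = 𝒩 E₁₂ 𝒱`. -/
noncomputable def opD2 (α β v : ℝ) : RightOp 2 :=
  opN α β v * dTerm 0 (constMat !![0, 1; 0, 0]) * opV α β v

/-- `D₃ = 𝒩 E₂₁ 𝒱`. -/
noncomputable def opD3 (α β v : ℝ) : RightOp 2 :=
  opN α β v * dTerm 0 (constMat !![0, 0; 1, 0]) * opV α β v

/-- `D₄ = 𝒩 E₂₂ 𝒱`. -/
noncomputable def opD4 (α β v : ℝ) : RightOp 2 :=
  opN α β v * dTerm 0 (constMat !![0, 0; 0, 1]) * opV α β v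

/-- `D₅ = D₁ + D₄`. -/
noncomputable def opD5 (α β v : ℝ) : RightOp 2 := opD1 α β v + opD4 α β v

/-- The nine operators `I`, `D_j`, `D₅ D_j` for `j = 1, 2, 3, 4`. -/
noncomputable def jacobiGenerators (α β v : ℝ) : Set (RightOp 2) :=
  {1, opD1 α β v, opD2 α β v, opD3 α β v, opD4 α β v,
    opD5 α β v * opD1 α β v, opD5 α β v * opD2 α β v,
    opD5 α β v * opD3 α β v, opD5 α β v * opD4 α β v}

/-! The theorem follows from a Darboux factorization over scalar Jacobi polynomials. Let `p_n` be
the Jacobi polynomial with parameters `α + 1`, `β + 1`, normalized by `p_n(1) = 1`, and let `y_n` be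
minus its eigenvalue. The weight is the scalar Jacobi weight times `(x - B) S (x - Bᵀ)` with `B² =
1`, and this makes `𝒩` the adjoint of `𝒱`, up to sign and the factor `(1 - x²) S`
(`momentMap_act_opV`). On scalar polynomials `𝒱𝒩` is the Jacobi operator minus a constant diagonal
matrix, so `p_n 𝒱𝒩 = -E(y_n) p_n` with `E(y) = diag(y + c₀, y + c₁)` (`act_opV_opN`). Hence `P_n =
p_n 𝒱` is an orthogonal sequence for `W`, and `𝒩 M 𝒱` has eigenvalue `-E(y_n) M` on it.

An operator is determined by its eigenvalues, so `𝒟(W)` is identified by describing all sequences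
`Λ_n`. Evaluating at `x = 1` shows that `Λ_n` is a polynomial in `y_n` (`eigenvalue_polynomial`).
Comparing the two top coefficients of `P_n · D` gives conditions at `y = -c₀` and `y = -c₁` which
force `Λ_n = c I + E(y_n) f(y_n)` with `f` a matrix polynomial (`eigenvalue_structure`).

Conversely every such sequence occurs. The scalar sequences `(y + c₀)(y + c₁) g(y)` come from
central operators (`exists_central`), so each entry of `f` matters only modulo this quadratic. The
two remaining coefficients per entry are supplied by `𝒩 E_ij 𝒱` and `D₅ 𝒩 E_ij 𝒱`, and `c` by the
identity. -/

/-! ### Matrix polynomials: adjoint, evaluation, moment functionals. -/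

/-- The coefficientwise conjugate transpose of a matrix polynomial. -/
noncomputable def adjPoly {N : ℕ} (Q : MatPoly N) : MatPoly N :=
  ∑ k ∈ Finset.range (Q.natDegree + 1), monomial k (Q.coeff k).conjTranspose

lemma adjPoly_coeff {N : ℕ} (Q : MatPoly N) (k : ℕ) :
    (adjPoly Q).coeff k = (Q.coeff k).conjTranspose := by
  simp only [adjPoly, finsetSum_coeff, coeff_monomial, Finset.sum_ite_eq', Finset.mem_range]
  split_ifs with h
  · rfl
  · rw [coeff_eq_zero_of_natDegree_lt (by omega), Matrix.conjTranspose_zero]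

lemma adjPoly_add {N : ℕ} (P Q : MatPoly N) : adjPoly (P + Q) = adjPoly P + adjPoly Q := by
  ext1 k; simp [adjPoly_coeff]

lemma adjPoly_neg {N : ℕ} (P : MatPoly N) : adjPoly (-P) = -adjPoly P := by
  ext1 k; simp [adjPoly_coeff]

lemma adjPoly_mul {N : ℕ} (P Q : MatPoly N) : adjPoly (P * Q) = adjPoly Q * adjPoly P := by
  ext1 k
  rw [adjPoly_coeff, coeff_mul, coeff_mul, Matrix.conjTranspose_sum,
    ← Finset.Nat.sum_antidiagonal_swap]
  simp [adjPoly_coeff]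

lemma adjPoly_C {N : ℕ} (A : Matrix (Fin N) (Fin N) ℂ) : adjPoly (C A) = C A.conjTranspose := by
  ext1 k
  rw [adjPoly_coeff, coeff_C, coeff_C]
  split_ifs <;> simp

lemma adjPoly_X {N : ℕ} : adjPoly (X : MatPoly N) = X := by
  ext1 k
  rw [adjPoly_coeff, coeff_X]
  split_ifs <;> simp

lemma adjPoly_derivative {N : ℕ} (P : MatPoly N) :
    adjPoly (derivative P) = derivative (adjPoly P) := by
  ext1 k
  rw [adjPoly_coeff, coeff_derivative, coeff_derivative, adjPoly_coeff]
  have : ((k : Matrix (Fin N) (Fin N) ℂ) + 1) = ((k + 1 : ℕ) : Matrix (Fin N) (Fin N) ℂ) := by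
    push_cast; rfl
  rw [this, Matrix.conjTranspose_mul, Matrix.conjTranspose_natCast]
  exact Nat.cast_commute _ _

/-- Evaluation at a scalar matrix, as a ring homomorphism. -/
noncomputable def evalScalar {N : ℕ} (z : ℂ) : MatPoly N →+* Matrix (Fin N) (Fin N) ℂ :=
  eval₂RingHom' (RingHom.id _) (Matrix.scalar (Fin N) z)
    fun A => (Matrix.scalar_commute z (fun _ => mul_comm _ _) A).symm

lemma evalScalar_apply {N : ℕ} (z : ℂ) (P : MatPoly N) :
    evalScalar z P = P.eval (Matrix.scalar (Fin N) z) := rfl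

lemma evalScalar_C {N : ℕ} (z : ℂ) (A : Matrix (Fin N) (Fin N) ℂ) :
    evalScalar z (C A) = A := by rw [evalScalar_apply, eval_C]

lemma evalScalar_X {N : ℕ} (z : ℂ) :
    evalScalar z (X : MatPoly N) = Matrix.scalar (Fin N) z := by rw [evalScalar_apply, eval_X]

lemma evalScalar_eq_sum {N : ℕ} (z : ℂ) (P : MatPoly N) {n : ℕ} (h : P.natDegree < n) :
    evalScalar z P = ∑ k ∈ Finset.range n, z ^ k • P.coeff k := by
  rw [evalScalar_apply, eval_eq_sum_range' h]
  refine Finset.sum_congr rfl fun k _ => ?_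
  rw [← map_pow]
  ext i j
  simp [Matrix.scalar_apply, mul_comm]

/-- Conjugation fixes powers of a real point. Thus the conjugate transpose in the weight form
becomes an algebraic operation on polynomials. -/
lemma evalScalar_adjPoly {N : ℕ} (x : ℝ) (P : MatPoly N) :
    evalScalar (x : ℂ) (adjPoly P) = (evalScalar (x : ℂ) P).conjTranspose := by
  have h : (adjPoly P).natDegree < P.natDegree + 1 := Nat.lt_succ_of_le <| by
    rw [natDegree_le_iff_coeff_eq_zero]
    intro k hk
    rw [adjPoly_coeff, coeff_eq_zero_of_natDegree_lt hk, Matrix.conjTranspose_zero]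
  rw [evalScalar_eq_sum _ _ h, evalScalar_eq_sum _ _ (Nat.lt_succ_self _),
    Matrix.conjTranspose_sum]
  simp [adjPoly_coeff, Matrix.conjTranspose_smul]

/-- The matrix-valued functional on matrix polynomials with moments `m`. -/
noncomputable def momentMap {N : ℕ} (m : ℕ → ℝ) :
    MatPoly N →ₗ[ℂ] Matrix (Fin N) (Fin N) ℂ :=
  Polynomial.lsum fun k => (m k : ℂ) • LinearMap.id

lemma momentMap_eq_sum {N : ℕ} (m : ℕ → ℝ) (P : MatPoly N) {n : ℕ} (h : P.natDegree < n) :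
    momentMap m P = ∑ k ∈ Finset.range n, (m k : ℂ) • P.coeff k := by
  rw [momentMap, Polynomial.lsum_apply, sum_over_range' _ (by simp) _ h]
  rfl

lemma momentMap_monomial {N : ℕ} (m : ℕ → ℝ) (k : ℕ) (A : Matrix (Fin N) (Fin N) ℂ) :
    momentMap m (monomial k A) = (m k : ℂ) • A := by
  rw [momentMap, Polynomial.lsum_apply, sum_monomial_index _ _ (by simp)]
  rfl

lemma momentMap_C_mul {N : ℕ} (m : ℕ → ℝ) (A : Matrix (Fin N) (Fin N) ℂ) (P : MatPoly N) :
    momentMap m (C A * P) = A * momentMap m P := by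
  induction P using Polynomial.induction_on' with
  | add p q hp hq => rw [mul_add, map_add, map_add, mul_add, hp, hq]
  | monomial k B => rw [C_mul_monomial, momentMap_monomial, momentMap_monomial, mul_smul_comm]

lemma momentMap_mul_C {N : ℕ} (m : ℕ → ℝ) (A : Matrix (Fin N) (Fin N) ℂ) (P : MatPoly N) :
    momentMap m (P * C A) = momentMap m P * A := by
  induction P using Polynomial.induction_on' with
  | add p q hp hq => rw [add_mul, map_add, map_add, add_mul, hp, hq]
  | monomial k B => rw [monomial_mul_C, momentMap_monomial, momentMap_monomial, smul_mul_assoc]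

/-! ### Simple sequences and uniqueness of orthogonal sequences. -/

/-- A family of matrix polynomials with `deg P_n = n` and nonsingular leading coefficients. -/
def IsSimpleSeq {N : ℕ} (P : ℕ → MatPoly N) : Prop :=
  ∀ n, (P n).natDegree = n ∧ IsUnit (P n).leadingCoeff

/-- One division step by the polynomial of the same degree in a simple sequence. -/
lemma IsSimpleSeq.exists_reduce {N : ℕ} {P : ℕ → MatPoly N} (hP : IsSimpleSeq P) {n : ℕ}
    {Q : MatPoly N} (hQ : Q.natDegree ≤ n) :
    ∃ (K : Matrix (Fin N) (Fin N) ℂ) (R : MatPoly N), Q = C K * P n + R ∧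
      K * (P n).leadingCoeff = Q.coeff n ∧ ∀ k, n ≤ k → R.coeff k = 0 := by
  obtain ⟨u, hu⟩ := (hP n).2
  have hl : (P n).coeff n = u := by rw [hu, leadingCoeff, (hP n).1]
  refine ⟨Q.coeff n * (↑u⁻¹ : Matrix _ _ ℂ), Q - C (Q.coeff n * (↑u⁻¹ : Matrix _ _ ℂ)) * P n,
    by abel, by rw [← hu, mul_assoc, Units.inv_mul, mul_one], fun k hk => ?_⟩
  rw [coeff_sub, coeff_C_mul]
  rcases hk.eq_or_lt with rfl | hk
  · rw [hl, mul_assoc, Units.inv_mul, mul_one, sub_self]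
  · rw [coeff_eq_zero_of_natDegree_lt (hQ.trans_lt hk),
      coeff_eq_zero_of_natDegree_lt (p := P n) (by rwa [(hP n).1]), mul_zero, sub_zero]

/-- A simple sequence spans the matrix polynomials as a left module over constant matrices. -/
lemma IsSimpleSeq.induction {N : ℕ} {P : ℕ → MatPoly N} (hP : IsSimpleSeq P)
    {p : MatPoly N → Prop} (h0 : p 0) (hadd : ∀ Q R, p Q → p R → p (Q + R)) (n : ℕ)
    (hmul : ∀ A, ∀ k < n, p (C A * P k)) (Q : MatPoly N) (hQ : ∀ k, n ≤ k → Q.coeff k = 0) :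
    p Q := by
  induction n generalizing Q with
  | zero =>
    have : Q = 0 := by ext1 k; simp [hQ k]
    rwa [this]
  | succ n ih =>
    obtain ⟨K, R, rfl, -, hR⟩ := hP.exists_reduce (Q := Q) (n := n) (by
      rw [natDegree_le_iff_coeff_eq_zero]; exact fun k hk => hQ k hk)
    exact hadd _ _ (hmul K n n.lt_succ_self)
      (ih (fun A k hk => hmul A k (hk.trans n.lt_succ_self)) R hR)

/-- Right operators commute with constant left factors, and a simple sequence spans over such
factors. This is why identities in `𝒟(W)` can be checked on eigenvalues. -/
lemma IsSimpleSeq.op_ext {N : ℕ} {P : ℕ → MatPoly N} (hP : IsSimpleSeq P) {D E : RightOp N}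
    (hD : IsMatDiffOp D) (hE : IsMatDiffOp E)
    (h : ∀ n, RightOp.act (P n) D = RightOp.act (P n) E) : D = E := by
  refine rightOp_ext fun Q => ?_
  refine hP.induction (p := fun Q => RightOp.act Q D = RightOp.act Q E) ?_ ?_ (Q.natDegree + 1)
    ?_ Q fun k hk => coeff_eq_zero_of_natDegree_lt hk
  · exact (map_zero D.unop).trans (map_zero E.unop).symm
  · intro Q R hQ hR; rw [add_act, add_act, hQ, hR]
  · intro A k _; rw [hD.act_C_mul, hE.act_C_mul, h]

/-- An operator having a simple sequence as eigenfunctions does not raise degrees. -/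
lemma IsSimpleSeq.coeff_act_eq_zero {N : ℕ} {P : ℕ → MatPoly N} (hP : IsSimpleSeq P)
    {D : RightOp N} (hD : IsMatDiffOp D) {Λ : ℕ → Matrix (Fin N) (Fin N) ℂ}
    (h : ∀ n, RightOp.act (P n) D = C (Λ n) * P n) {n : ℕ} {Q : MatPoly N}
    (hQ : ∀ k, n ≤ k → Q.coeff k = 0) (j : ℕ) (hj : n ≤ j) : (RightOp.act Q D).coeff j = 0 := by
  refine hP.induction (p := fun Q => (RightOp.act Q D).coeff j = 0) ?_ ?_ n ?_ Q hQ
  · exact (congrArg (fun R => R.coeff j) (map_zero D.unop)).trans (coeff_zero j)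
  · intro Q R hQ hR; rw [add_act, coeff_add, hQ, hR, add_zero]
  · intro A k hk
    rw [hD.act_C_mul, h, coeff_C_mul, coeff_C_mul,
      coeff_eq_zero_of_natDegree_lt (by rw [(hP k).1]; omega), mul_zero, mul_zero]

/-- Two simple sequences orthogonal for a sesquilinear form with nondegenerate norms agree up to
constant left factors. -/
lemma IsSimpleSeq.eq_C_mul_of_orthogonal {N : ℕ} {P Q : ℕ → MatPoly N} (hP : IsSimpleSeq P)
    (hQ : IsSimpleSeq Q) (f : MatPoly N → MatPoly N → Matrix (Fin N) (Fin N) ℂ)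
    (hl : ∀ R S T, f (R + S) T = f R T + f S T) (hr : ∀ R S T, f T (R + S) = f T R + f T S)
    (hlC : ∀ A R S, f (C A * R) S = A * f R S)
    (hrC : ∀ A R S, f R (C A * S) = f R S * A.conjTranspose)
    (oP : ∀ n m, n ≠ m → f (P n) (P m) = 0) (oQ : ∀ n m, n ≠ m → f (Q n) (Q m) = 0)
    (hu : ∀ n, IsUnit (f (Q n) (Q n))) (n : ℕ) :
    ∃ K, P n = C K * Q n := by
  have hl0 : ∀ T, f 0 T = 0 := fun T => by simpa using hl 0 0 T
  have hr0 : ∀ T, f T 0 = 0 := fun T => by simpa using hr 0 0 T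
  obtain ⟨K, R, hR, -, hR0⟩ := hQ.exists_reduce (hP n).1.le
  refine ⟨K, ?_⟩
  -- Each `Q k` with `k < n` is a left combination of `P 0, …, P k`, hence orthogonal to `P n`.
  have hfR : ∀ k < n, f R (Q k) = 0 := by
    intro k hk
    have h1 : f (P n) (Q k) = 0 := by
      refine hP.induction (p := fun T => f (P n) T = 0) (hr0 _)
        (fun S T hS hT => by rw [hr, hS, hT, add_zero]) (k + 1) (fun A j hj => ?_) (Q k)
        fun j hj => coeff_eq_zero_of_natDegree_lt (by rw [(hQ k).1]; omega)
      rw [hrC, oP _ _ (by omega), zero_mul]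
    rw [hR, hl, hlC, oQ _ _ hk.ne', mul_zero, zero_add] at h1
    exact h1
  -- The coefficients of `R` are cleared from the top down: pairing with `Q k` isolates the leading
  -- one, times the invertible norm of `Q k`.
  have key : ∀ j ≤ n, ∀ k, n - j ≤ k → R.coeff k = 0 := by
    intro j
    induction j with
    | zero => exact fun _ k hk => hR0 k hk
    | succ j ih =>
      intro hj k hk
      rcases Nat.lt_or_ge k (n - j) with hk' | hk'
      swap
      · exact ih (by omega) k hk'
      obtain ⟨K', R', hR', hlead, hR0'⟩ := hQ.exists_reduce (Q := R) (n := k) (by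
        rw [natDegree_le_iff_coeff_eq_zero]
        exact fun i hi => ih (by omega) i (by omega))
      have h2 : f R' (Q k) = 0 := by
        refine hQ.induction (p := fun T => f T (Q k) = 0) (hl0 _)
          (fun S T hS hT => by rw [hl, hS, hT, add_zero]) k (fun A i hi => ?_) R' hR0'
        rw [hlC, oQ _ _ hi.ne, mul_zero]
      have h3 := hfR k (by omega)
      rw [hR', hl, hlC, h2, add_zero] at h3
      rw [← hlead, (hu k).mul_left_eq_zero.1 h3, zero_mul]
  have : R = 0 := by ext1 k; simpa using key n le_rfl k (by omega)
  rw [hR, this, add_zero]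

/-! ### The scalar Jacobi weight: integrability, Pearson equation, moments. -/

/-- The scalar Jacobi weight on `(-1, 1)`. -/
noncomputable def jacobiDensity (α β x : ℝ) : ℝ := (1 - x) ^ α * (1 + x) ^ β

/-- Cutting at `0` leaves one possibly singular factor on each half, the other being continuous
there. -/
lemma integrableOn_jacobiDensity {α β : ℝ} (hα : -1 < α) (hβ : -1 < β) {f : ℝ → ℝ}
    (hf : Continuous f) :
    MeasureTheory.IntegrableOn (fun x => jacobiDensity α β x * f x) (Set.Ioo (-1) 1) := by
  have h1 : IntervalIntegrable (fun x : ℝ => jacobiDensity α β x * f x)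
      MeasureTheory.volume (-1) 0 := by
    have h : IntervalIntegrable (fun x : ℝ => (1 + x) ^ β) MeasureTheory.volume (-1) 0 := by
      have := (intervalIntegral.intervalIntegrable_rpow' hβ (a := 0) (b := 1)).comp_add_left 1
      simpa using this
    have hc : ContinuousOn (fun x : ℝ => (1 - x) ^ α * f x) (Set.uIcc (-1) 0) := by
      refine ContinuousOn.mul (ContinuousOn.rpow_const (by fun_prop) fun x hx => Or.inl ?_)
        hf.continuousOn
      rw [Set.uIcc_of_le (by norm_num)] at hx
      linarith [hx.2]
    refine (h.mul_continuousOn hc).congr fun x _ => ?_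
    simp only [jacobiDensity]; ring
  have h2 : IntervalIntegrable (fun x : ℝ => jacobiDensity α β x * f x)
      MeasureTheory.volume 0 1 := by
    have h : IntervalIntegrable (fun x : ℝ => (1 - x) ^ α) MeasureTheory.volume 0 1 := by
      have := (intervalIntegral.intervalIntegrable_rpow' hα (a := 1) (b := 0)).comp_sub_left 1
      simpa using this
    have hc : ContinuousOn (fun x : ℝ => (1 + x) ^ β * f x) (Set.uIcc 0 1) := by
      refine ContinuousOn.mul (ContinuousOn.rpow_const (by fun_prop) fun x hx => Or.inl ?_)
        hf.continuousOn
      rw [Set.uIcc_of_le (by norm_num)] at hx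
      linarith [hx.1]
    refine (h.mul_continuousOn hc).congr fun x _ => ?_
    simp only [jacobiDensity]; ring
  have h3 := h1.trans h2
  rw [intervalIntegrable_iff_integrableOn_Ioo_of_le (by norm_num)] at h3
  exact h3

/-- Integration by parts against the Jacobi weight. -/
lemma integral_jacobiDensity_pearson {α β : ℝ} (hα : -1 < α) (hβ : -1 < β) (f : ℝ[X]) :
    ∫ x in Set.Ioo (-1 : ℝ) 1, jacobiDensity α β x *
      (derivative f * (1 - X ^ 2) + f * (C (β - α) - C (α + β + 2) * X)).eval x = 0 := by
  set g : ℝ[X] := derivative f * (1 - X ^ 2) + f * (C (β - α) - C (α + β + 2) * X) with hg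
  have hint := integrableOn_jacobiDensity hα hβ g.continuous
  rw [← intervalIntegrable_iff_integrableOn_Ioo_of_le (by norm_num)] at hint
  rw [← MeasureTheory.integral_Ioc_eq_integral_Ioo,
    ← intervalIntegral.integral_of_le (by norm_num)]
  -- The integrand is the derivative of `(1 - x)^(α+1) (1 + x)^(β+1) f`, which vanishes at both ends
  -- because `α, β > -1`.
  rw [intervalIntegral.integral_eq_sub_of_hasDerivAt_of_le (by norm_num)
    (f := fun x => (1 - x) ^ (α + 1) * (1 + x) ^ (β + 1) * f.eval x) ?_ ?_ hint]
  · rw [sub_self, show (1 : ℝ) + -1 = 0 by norm_num, Real.zero_rpow (by linarith),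
      Real.zero_rpow (by linarith)]
    ring
  · refine ContinuousOn.mul (ContinuousOn.mul ?_ ?_) f.continuous.continuousOn
    · exact ContinuousOn.rpow_const (by fun_prop) fun x _ => Or.inr (by linarith)
    · exact ContinuousOn.rpow_const (by fun_prop) fun x _ => Or.inr (by linarith)
  · intro x hx
    have hx1 : 0 < 1 - x := by linarith [hx.2]
    have hx2 : 0 < 1 + x := by linarith [hx.1]
    have d1 : HasDerivAt (fun x : ℝ => (1 - x) ^ (α + 1)) (-(α + 1) * (1 - x) ^ α) x := by
      have := ((hasDerivAt_id' x).const_sub 1).rpow_const (p := α + 1) (Or.inl hx1.ne')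
      convert this using 1
      rw [add_sub_cancel_right]; ring
    have d2 : HasDerivAt (fun x : ℝ => (1 + x) ^ (β + 1)) ((β + 1) * (1 + x) ^ β) x := by
      have := ((hasDerivAt_id' x).const_add 1).rpow_const (p := β + 1) (Or.inl hx2.ne')
      convert this using 1
      rw [add_sub_cancel_right]; ring
    refine HasDerivAt.congr_deriv ((d1.mul d2).mul (f.hasDerivAt x)) ?_
    simp only [Pi.mul_apply]
    simp only [hg, jacobiDensity, eval_add, eval_mul, eval_sub, eval_one, eval_pow, eval_X, eval_C]
    rw [Real.rpow_add_one hx1.ne', Real.rpow_add_one hx2.ne']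
    ring

lemma integral_jacobiDensity_pos {α β : ℝ} (hα : -1 < α) (hβ : -1 < β) {p : ℝ[X]} (hp : p ≠ 0) :
    0 < ∫ x in Set.Ioo (-1 : ℝ) 1, jacobiDensity α β x * ((1 - X ^ 2) * p * p).eval x := by
  have hpos : ∀ x ∈ Set.Ioo (-1 : ℝ) 1, 0 < jacobiDensity α β x ∧ 0 < 1 - x ^ 2 := fun x hx =>
    ⟨mul_pos (Real.rpow_pos_of_pos (by linarith [hx.2]) _)
      (Real.rpow_pos_of_pos (by linarith [hx.1]) _), by nlinarith [hx.1, hx.2]⟩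
  have hint := integrableOn_jacobiDensity hα hβ ((1 - X ^ 2) * p * p).continuous
  have heval : ∀ x, ((1 - X ^ 2) * p * p).eval x = (1 - x ^ 2) * (p.eval x * p.eval x) := by
    intro x; simp [mul_assoc]
  rw [MeasureTheory.setIntegral_pos_iff_support_of_nonneg_ae ?_ hint]
  · have hsub : Set.Ioo (-1 : ℝ) 1 \ {x | p.IsRoot x} ⊆
        Function.support (fun x => jacobiDensity α β x * ((1 - X ^ 2) * p * p).eval x) ∩
          Set.Ioo (-1 : ℝ) 1 := by
      rintro x ⟨hx, hr⟩
      refine ⟨?_, hx⟩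
      rw [Function.mem_support, heval]
      exact mul_ne_zero (hpos x hx).1.ne' (mul_ne_zero (hpos x hx).2.ne' (mul_ne_zero hr hr))
    refine lt_of_lt_of_le ?_ (MeasureTheory.measure_mono hsub)
    rw [MeasureTheory.measure_sdiff_null ((finite_setOfPred_isRoot hp).measure_zero _),
      Real.volume_Ioo]
    norm_num
  · refine (MeasureTheory.ae_restrict_iff' measurableSet_Ioo).2 (Filter.Eventually.of_forall ?_)
    intro x hx
    simp only [heval, Pi.zero_apply]
    exact mul_nonneg (hpos x hx).1.le (mul_nonneg (hpos x hx).2.le (mul_self_nonneg _))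

/-- The moments of the scalar Jacobi weight. -/
noncomputable def jacobiMoment (α β : ℝ) (k : ℕ) : ℝ :=
  ∫ x in Set.Ioo (-1 : ℝ) 1, jacobiDensity α β x * x ^ k

/-- This is Pearson's equation for `f = x^k`. At `k = 0` the truncated index `k - 1` is harmless,
its coefficient being zero. -/
lemma jacobiMoment_recurrence {α β : ℝ} (hα : -1 < α) (hβ : -1 < β) (k : ℕ) :
    k * jacobiMoment α β (k - 1) - k * jacobiMoment α β (k + 1)
      + (β - α) * jacobiMoment α β k - (α + β + 2) * jacobiMoment α β (k + 1) = 0 := by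
  have hi : ∀ j, MeasureTheory.IntegrableOn (fun x => jacobiDensity α β x * x ^ j)
      (Set.Ioo (-1) 1) := fun j => integrableOn_jacobiDensity hα hβ (by fun_prop)
  have hc : ∀ (c : ℝ) j, MeasureTheory.IntegrableOn
      (fun x => c * (jacobiDensity α β x * x ^ j)) (Set.Ioo (-1) 1) :=
    fun c j => (hi j).const_mul c
  have he : ∀ x : ℝ, jacobiDensity α β x * (derivative (X ^ k : ℝ[X]) * (1 - X ^ 2) +
      X ^ k * (C (β - α) - C (α + β + 2) * X)).eval x =
        k * (jacobiDensity α β x * x ^ (k - 1)) - k * (jacobiDensity α β x * x ^ (k + 1))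
        + (β - α) * (jacobiDensity α β x * x ^ k)
        - (α + β + 2) * (jacobiDensity α β x * x ^ (k + 1)) := by
    intro x
    rw [derivative_X_pow]
    simp only [eval_add, eval_mul, eval_sub, eval_one, eval_pow, eval_X, eval_C]
    rcases k with _ | k
    · simp; ring
    · simp; ring
  have h := integral_jacobiDensity_pearson hα hβ (X ^ k)
  simp only [he] at h
  erw [MeasureTheory.integral_sub (((hc _ _).sub (hc _ _)).add (hc _ _)) (hc _ _),
    MeasureTheory.integral_add ((hc _ _).sub (hc _ _)) (hc _ _),
    MeasureTheory.integral_sub (hc _ _) (hc _ _)] at h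
  simp only [MeasureTheory.integral_const_mul] at h
  exact h

/-! ### The matrix weight form as a moment functional. -/

/-- Scalar polynomials inside matrix polynomials. -/
noncomputable def scalarPoly {N : ℕ} : ℝ[X] →+* MatPoly N :=
  mapRingHom (algebraMap ℝ (Matrix (Fin N) (Fin N) ℂ))

lemma scalarPoly_coeff {N : ℕ} (p : ℝ[X]) (k : ℕ) :
    (scalarPoly p : MatPoly N).coeff k = algebraMap ℝ _ (p.coeff k) := by
  rw [scalarPoly, coe_mapRingHom, coeff_map]

lemma scalarPoly_derivative {N : ℕ} (p : ℝ[X]) :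
    derivative (scalarPoly p : MatPoly N) = scalarPoly (derivative p) := by
  rw [scalarPoly, coe_mapRingHom, derivative_map]

lemma scalarPoly_X {N : ℕ} : (scalarPoly X : MatPoly N) = X := by
  rw [scalarPoly, coe_mapRingHom, map_X]

lemma scalarPoly_C {N : ℕ} (r : ℝ) :
    (scalarPoly (C r) : MatPoly N) = C (algebraMap ℝ _ r) := by
  rw [scalarPoly, coe_mapRingHom, map_C]

lemma scalarPoly_commute {N : ℕ} (p : ℝ[X]) (Q : MatPoly N) : Commute (scalarPoly p) Q := by
  induction p using Polynomial.induction_on with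
  | C a =>
    rw [scalarPoly_C]
    refine Polynomial.induction_on' Q (fun _ _ => Commute.add_right) fun k A => ?_
    rw [Commute, SemiconjBy, C_mul_monomial, monomial_mul_C, Algebra.commutes]
  | add p q hp hq => rw [map_add]; exact hp.add_left hq
  | monomial n a h =>
    rw [pow_succ, ← mul_assoc, map_mul, scalarPoly_X]
    exact h.mul_left (X_mul)

/-- Pearson's equation for the matrix-valued moment functional. -/
lemma momentMap_pearson {N : ℕ} {α β : ℝ} (hα : -1 < α) (hβ : -1 < β) (F : MatPoly N) :
    momentMap (jacobiMoment α β) (derivative F * scalarPoly (1 - X ^ 2)) =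
      -momentMap (jacobiMoment α β) (F * scalarPoly (C (β - α) - C (α + β + 2) * X)) := by
  rw [eq_neg_iff_add_eq_zero]
  induction F using Polynomial.induction_on' with
  | add p q hp hq =>
    rw [derivative_add, add_mul, add_mul, map_add, map_add, add_add_add_comm, hp, hq, add_zero]
  | monomial k A =>
    have h := congrArg (fun r : ℝ => (r : ℂ)) (jacobiMoment_recurrence hα hβ k)
    simp only [Complex.ofReal_add, Complex.ofReal_sub, Complex.ofReal_mul, Complex.ofReal_natCast,
      Complex.ofReal_zero] at h
    have e1 : derivative (monomial k A) * scalarPoly (1 - X ^ 2) =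
        monomial (k - 1) (A * k) - monomial (k + 1) (A * k) := by
      rw [derivative_monomial, map_sub, map_one, map_pow, scalarPoly_X, mul_sub, mul_one,
        monomial_mul_X_pow]
      rcases k with _ | k
      · simp
      · rfl
    have e2 : monomial k A * scalarPoly (C (β - α) - C (α + β + 2) * X) =
        monomial k (A * algebraMap ℝ _ (β - α)) -
          monomial (k + 1) (A * algebraMap ℝ _ (α + β + 2)) := by
      rw [map_sub, map_mul, scalarPoly_X, scalarPoly_C, scalarPoly_C, mul_sub, monomial_mul_C,
        ← mul_assoc, monomial_mul_C, monomial_mul_X]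
    rw [e1, e2, map_sub, map_sub]
    simp only [momentMap_monomial]
    ext i j
    have n1 : (A * (k : Matrix (Fin N) (Fin N) ℂ)) i j = A i j * k := by
      rw [← nsmul_eq_mul', Matrix.smul_apply, nsmul_eq_mul, mul_comm]
    have n2 : ∀ r : ℝ, (A * algebraMap ℝ (Matrix (Fin N) (Fin N) ℂ) r) i j = A i j * r := by
      intro r
      rw [← Algebra.commutes, ← Algebra.smul_def, Matrix.smul_apply, Complex.real_smul, mul_comm]
    simp only [Matrix.add_apply, Matrix.sub_apply, Matrix.smul_apply, n1, n2, smul_eq_mul,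
      Matrix.zero_apply, Complex.ofReal_add, Complex.ofReal_sub]
    linear_combination A i j * h

lemma integral_eq_sum_moments {α β : ℝ} (hα : -1 < α) (hβ : -1 < β) (p : ℝ[X]) {n : ℕ}
    (h : p.natDegree < n) :
    ∫ x in Set.Ioo (-1 : ℝ) 1, jacobiDensity α β x * p.eval x =
      ∑ k ∈ Finset.range n, jacobiMoment α β k * p.coeff k := by
  simp only [jacobiMoment, ← MeasureTheory.integral_mul_const]
  rw [← MeasureTheory.integral_finsetSum]
  · congr 1
    ext x
    rw [eval_eq_sum_range' h, Finset.mul_sum]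
    exact Finset.sum_congr rfl fun k _ => by ring
  · exact fun k _ => (integrableOn_jacobiDensity hα hβ (by fun_prop)).mul_const _

lemma momentMap_scalarPoly {N : ℕ} {α β : ℝ} (hα : -1 < α) (hβ : -1 < β) (p : ℝ[X]) :
    momentMap (jacobiMoment α β) (scalarPoly p : MatPoly N) =
      algebraMap ℝ _ (∫ x in Set.Ioo (-1 : ℝ) 1, jacobiDensity α β x * p.eval x) := by
  have hd : (scalarPoly p : MatPoly N).natDegree < p.natDegree + 1 :=
    Nat.lt_succ_of_le natDegree_map_le
  rw [integral_eq_sum_moments hα hβ p (Nat.lt_succ_self _), map_sum, momentMap_eq_sum _ _ hd]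
  refine Finset.sum_congr rfl fun k _ => ?_
  rw [scalarPoly_coeff, map_mul, ← Algebra.smul_def]
  ext i j
  simp

/-- The matrix weight form is given by the moment functional when the weight is the scalar Jacobi
weight times a matrix polynomial. -/
lemma weightForm_eq_momentMap {N : ℕ} {α β : ℝ} (hα : -1 < α) (hβ : -1 < β)
    {W : ℝ → Matrix (Fin N) (Fin N) ℂ} {w : MatPoly N}
    (hW : ∀ x, W x = (jacobiDensity α β x : ℂ) • evalScalar (x : ℂ) w) (P Q : MatPoly N) :
    weightForm (Set.Ioo (-1) 1) W P Q = momentMap (jacobiMoment α β) (P * w * adjPoly Q) := by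
  have h : ∀ x : ℝ, P.eval (Matrix.scalar (Fin N) (x : ℂ)) * W x *
      (Q.eval (Matrix.scalar (Fin N) (x : ℂ))).conjTranspose =
        (jacobiDensity α β x : ℂ) • evalScalar (x : ℂ) (P * w * adjPoly Q) := by
    intro x
    rw [map_mul, map_mul, evalScalar_adjPoly, hW, mul_smul_comm, smul_mul_assoc]
    rfl
  ext i j
  simp only [weightForm, Matrix.of_apply, h]
  generalize P * w * adjPoly Q = R
  rw [momentMap_eq_sum _ R (Nat.lt_succ_self _)]
  simp only [evalScalar_eq_sum _ R (Nat.lt_succ_self _), Matrix.smul_apply, Matrix.sum_apply,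
    smul_eq_mul, Finset.mul_sum]
  have hi : ∀ k, MeasureTheory.IntegrableOn (fun x : ℝ => ((jacobiDensity α β x * x ^ k : ℝ) : ℂ))
      (Set.Ioo (-1) 1) := fun k => (integrableOn_jacobiDensity hα hβ (by fun_prop)).ofReal
  have hc : ∀ (k : ℕ) (x : ℝ), (jacobiDensity α β x : ℂ) * ((x : ℂ) ^ k * R.coeff k i j) =
      ((jacobiDensity α β x * x ^ k : ℝ) : ℂ) * R.coeff k i j := by
    intro k x; push_cast; ring
  simp only [hc]
  rw [MeasureTheory.integral_finsetSum _ fun k _ => (hi k).mul_const _]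
  refine Finset.sum_congr rfl fun k _ => ?_
  rw [MeasureTheory.integral_mul_const, integral_complex_ofReal, jacobiMoment]

/-! ### Scalar Jacobi polynomials expanded at `x = 1`. -/

/-- Minus the eigenvalue of the Jacobi operator with parameters `α + 1`, `β + 1` in degree `n`. -/
noncomputable def jacobiEig (α β : ℝ) (n : ℕ) : ℝ := n * (n + (α + β + 2) + 1)

/-- The Taylor coefficients at `1` of the Jacobi polynomials, as polynomials in the eigenvalue. -/
noncomputable def jacobiTaylor (α β : ℝ) (k : ℕ) : ℝ[X] :=
  ∏ j ∈ Finset.range k,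
    (C (2 * (j + 1) * (j + α + 2))⁻¹ * (X - C (jacobiEig α β j)))

/-- In powers of `x - 1` the Jacobi equation with eigenvalue `-y` is exactly this two-term
recurrence. -/
lemma jacobiTaylor_succ {α β : ℝ} (hα : -1 < α) (k : ℕ) (y : ℝ) :
    2 * (k + 1) * (k + α + 2) * (jacobiTaylor α β (k + 1)).eval y =
      (y - jacobiEig α β k) * (jacobiTaylor α β k).eval y := by
  have h : (k : ℝ) + α + 2 ≠ 0 := by have := k.cast_nonneg (α := ℝ); linarith
  have h' : (k : ℝ) + 1 ≠ 0 := by positivity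
  rw [jacobiTaylor, Finset.prod_range_succ, ← jacobiTaylor, eval_mul, eval_mul, eval_C, eval_sub,
    eval_X, eval_C]
  field_simp

lemma jacobiTaylor_eval_of_lt {α β : ℝ} {n k : ℕ} (h : n < k) :
    (jacobiTaylor α β k).eval (jacobiEig α β n) = 0 := by
  rw [jacobiTaylor, eval_prod]
  exact Finset.prod_eq_zero (Finset.mem_range.2 h) (by simp)

lemma jacobiEig_strictMono {α β : ℝ} (h : 0 < α + β + 2) : StrictMono (jacobiEig α β) := by
  refine strictMono_nat_of_lt_succ fun n => ?_
  have := n.cast_nonneg (α := ℝ)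
  simp only [jacobiEig]; push_cast; nlinarith

lemma jacobiTaylor_eval_ne_zero {α β : ℝ} (hα : -1 < α) (h : 0 < α + β + 2) (n : ℕ) :
    (jacobiTaylor α β n).eval (jacobiEig α β n) ≠ 0 := by
  rw [jacobiTaylor, eval_prod, Finset.prod_ne_zero_iff]
  intro j hj
  have h1 : (j : ℝ) + α + 2 ≠ 0 := by have := j.cast_nonneg (α := ℝ); linarith
  have h2 : (j : ℝ) + 1 ≠ 0 := by positivity
  have h3 := jacobiEig_strictMono h (Finset.mem_range.1 hj)
  rw [eval_mul, eval_C, eval_sub, eval_X, eval_C]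
  exact mul_ne_zero (inv_ne_zero (by positivity)) (sub_ne_zero.2 h3.ne')

/-- The Jacobi polynomial in the variable `x - 1`. -/
noncomputable def shiftedJacobi (α β : ℝ) (n : ℕ) : ℝ[X] :=
  ∑ k ∈ Finset.range (n + 1), monomial k ((jacobiTaylor α β k).eval (jacobiEig α β n))

lemma shiftedJacobi_coeff (α β : ℝ) (n k : ℕ) :
    (shiftedJacobi α β n).coeff k = (jacobiTaylor α β k).eval (jacobiEig α β n) := by
  simp only [shiftedJacobi, finsetSum_coeff, coeff_monomial, Finset.sum_ite_eq', Finset.mem_range]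
  split_ifs with h
  · rfl
  · exact (jacobiTaylor_eval_of_lt (by omega)).symm

/-- The Jacobi polynomial with parameters `α + 1`, `β + 1`, with value `1` at `1`. -/
noncomputable def jacobiPoly (α β : ℝ) (n : ℕ) : ℝ[X] := taylor (-1) (shiftedJacobi α β n)

/-- Here `X` stands for `x - 1`, so that `X (X + 2) = x² - 1`. -/
lemma shiftedJacobi_ode {α β : ℝ} (hα : -1 < α) (n : ℕ) :
    X * (X + 2) * derivative (derivative (shiftedJacobi α β n)) +
      (C (2 * α + 4) + C (α + β + 4) * X) * derivative (shiftedJacobi α β n) =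
      C (jacobiEig α β n) * shiftedJacobi α β n := by
  have e : ∀ q : ℝ[X], X * (X + 2) * derivative (derivative q) +
      (C (2 * α + 4) + C (α + β + 4) * X) * derivative q =
      X * (X * derivative (derivative q)) + C 2 * (X * derivative (derivative q)) +
        C (2 * α + 4) * derivative q + C (α + β + 4) * (X * derivative q) := by
    intro q
    rw [show (C (2 : ℝ)) = 2 from rfl]
    ring
  rw [e]
  ext k
  have h := jacobiTaylor_succ (β := β) hα k (jacobiEig α β n)
  rcases k with _ | _ | k <;>
  · simp only [coeff_add, coeff_C_mul, coeff_X_mul, coeff_X_mul_zero, coeff_derivative,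
      shiftedJacobi_coeff]
    simp only [jacobiEig] at h ⊢
    push_cast at h ⊢
    linear_combination h

lemma jacobiPoly_ode {α β : ℝ} (hα : -1 < α) (n : ℕ) :
    derivative (derivative (jacobiPoly α β n)) * (1 - X ^ 2) +
      derivative (jacobiPoly α β n) * (C (β - α) - C (α + β + 4) * X) =
      -(C (jacobiEig α β n) * jacobiPoly α β n) := by
  have h := congrArg (taylor (-1)) (shiftedJacobi_ode (β := β) hα n)
  have hd : ∀ q : ℝ[X], derivative (taylor (-1) q) = taylor (-1) (derivative q) := by
    intro q
    rw [taylor_apply, taylor_apply, derivative_comp]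
    simp
  simp only [map_add, taylor_mul, taylor_C, taylor_X] at h
  have h2 : taylor (-1) (2 : ℝ[X]) = 2 := taylor_C (-1) (2 : ℝ)
  rw [h2] at h
  simp only [jacobiPoly, hd]
  have e1 : (C (β - α) : ℝ[X]) = C β - C α := C_sub
  have e2 : (C (α + β + 4) : ℝ[X]) = C α + C β + 4 := by rw [C_add, C_add]; rfl
  have e3 : (C (2 * α) : ℝ[X]) = 2 * C α := by rw [C_mul]; rfl
  have e4 : (C (-1) : ℝ[X]) = -1 := by simp
  rw [e3, e4, show (C (4 : ℝ)) = 4 from rfl] at h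
  rw [e1, e2]
  linear_combination -h

lemma jacobiPoly_natDegree {α β : ℝ} (hα : -1 < α) (h : 0 < α + β + 2) (n : ℕ) :
    (jacobiPoly α β n).natDegree = n := by
  rw [jacobiPoly, natDegree_taylor]
  refine natDegree_eq_of_le_of_coeff_ne_zero ?_ ?_
  · rw [natDegree_le_iff_coeff_eq_zero]
    intro k hk
    rw [shiftedJacobi_coeff, jacobiTaylor_eval_of_lt hk]
  · rw [shiftedJacobi_coeff]
    exact jacobiTaylor_eval_ne_zero hα h n

lemma jacobiPoly_coeff_ne_zero {α β : ℝ} (hα : -1 < α) (h : 0 < α + β + 2) (n : ℕ) :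
    (jacobiPoly α β n).coeff n ≠ 0 := by
  have h1 := jacobiPoly_natDegree hα h n
  have h2 : jacobiPoly α β n ≠ 0 := by
    intro h0
    have h3 : shiftedJacobi α β n = 0 := by
      have := taylor_injective (-1 : ℝ) (h0.trans (map_zero (taylor (-1))).symm)
      exact this
    have := jacobiTaylor_eval_ne_zero hα h n
    rw [← shiftedJacobi_coeff, h3, coeff_zero] at this
    exact this rfl
  have := leadingCoeff_ne_zero.2 h2
  rwa [leadingCoeff, h1] at this

/-- The coefficient of `x^n` in the Jacobi equation for degree `n + 1`; the factor on the left is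
the gap between the eigenvalues of degrees `n + 1` and `n`. -/
lemma jacobiPoly_subleading {α β : ℝ} (hα : -1 < α) (h : 0 < α + β + 2) (n : ℕ) :
    (2 * ((n : ℝ) + 1) + (α + β + 2)) * (jacobiPoly α β (n + 1)).coeff n =
      (α - β) * (n + 1) * (jacobiPoly α β (n + 1)).coeff (n + 1) := by
  have ho := jacobiPoly_ode (β := β) hα (n + 1)
  have hz : (jacobiPoly α β (n + 1)).coeff (n + 2) = 0 :=
    coeff_eq_zero_of_natDegree_lt (by rw [jacobiPoly_natDegree hα h]; omega)
  generalize jacobiPoly α β (n + 1) = p at *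
  have e : derivative (derivative p) * (1 - X ^ 2) +
      derivative p * (C (β - α) - C (α + β + 4) * X) = derivative (derivative p)
      - X * (X * derivative (derivative p)) + C (β - α) * derivative p
      - C (α + β + 4) * (X * derivative p) := by ring
  rw [e] at ho
  have hc := congrArg (fun q => q.coeff n) ho
  rcases n with _ | _ | n <;>
  · simp only [coeff_add, coeff_sub, coeff_neg, coeff_C_mul, coeff_X_mul, coeff_X_mul_zero,
      coeff_derivative, jacobiEig] at hc hz ⊢
    push_cast at hc hz ⊢
    simp only [zero_add, Nat.reduceAdd, add_assoc] at hc hz ⊢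
    rw [hz] at hc
    linear_combination hc

lemma jacobiPoly_iterate_derivative_eval_one (α β : ℝ) (n i : ℕ) :
    (derivative^[i] (jacobiPoly α β n)).eval 1 =
      (C (i.factorial : ℝ) * jacobiTaylor α β i).eval (jacobiEig α β n) := by
  have h : taylor 1 (jacobiPoly α β n) = shiftedJacobi α β n := by
    rw [jacobiPoly, taylor_taylor]; simp
  rw [← factorial_smul_hasseDeriv, LinearMap.smul_apply, eval_smul, ← taylor_coeff, h,
    shiftedJacobi_coeff, eval_mul, eval_C, nsmul_eq_mul]

/-- Orthogonality of the Jacobi polynomials, in Pearson form. -/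
lemma jacobiPoly_wronskian {α β : ℝ} (hα : -1 < α) (n m : ℕ) (g : ℝ[X])
    (hg : g = (1 - X ^ 2) * (derivative (jacobiPoly α β n) * jacobiPoly α β m -
      jacobiPoly α β n * derivative (jacobiPoly α β m))) :
    derivative g * (1 - X ^ 2) + g * (C (β - α) - C (α + β + 2) * X) =
      C (jacobiEig α β m - jacobiEig α β n) *
        ((1 - X ^ 2) * jacobiPoly α β n * jacobiPoly α β m) := by
  have h1 := jacobiPoly_ode (β := β) hα n
  have h2 := jacobiPoly_ode (β := β) hα m
  subst hg
  generalize jacobiPoly α β n = p at *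
  generalize jacobiPoly α β m = q at *
  have e2 : (C (α + β + 4) : ℝ[X]) = C (α + β + 2) + 2 := by
    rw [show (2 : ℝ[X]) = C 2 from rfl, ← C_add]; congr 1; ring
  rw [e2] at h1 h2
  have e3 : derivative (1 - X ^ 2 : ℝ[X]) = -2 * X := by
    rw [derivative_sub, derivative_one, derivative_X_sq]
    simp only [map_ofNat]; ring
  rw [derivative_mul, e3, derivative_sub, derivative_mul, derivative_mul,
    (C_sub : C (jacobiEig α β m - jacobiEig α β n) = _)]
  linear_combination (1 - X ^ 2) * q * h1 - (1 - X ^ 2) * p * h2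

lemma jacobiPoly_orthogonal {α β : ℝ} (hα : -1 < α) (hβ : -1 < β) {n m : ℕ} (h : n ≠ m) :
    ∫ x in Set.Ioo (-1 : ℝ) 1, jacobiDensity α β x *
      ((1 - X ^ 2) * jacobiPoly α β n * jacobiPoly α β m).eval x = 0 := by
  have h1 := integral_jacobiDensity_pearson hα hβ ((1 - X ^ 2) *
    (derivative (jacobiPoly α β n) * jacobiPoly α β m -
      jacobiPoly α β n * derivative (jacobiPoly α β m)))
  rw [jacobiPoly_wronskian hα n m _ rfl] at h1
  simp only [eval_C_mul, mul_left_comm (jacobiDensity α β _)] at h1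
  rw [MeasureTheory.integral_const_mul] at h1
  exact (mul_eq_zero.1 h1).resolve_left
    (sub_ne_zero.2 fun h' => h ((jacobiEig_strictMono (by linarith)).injective h').symm)

/-! ### Factorization of the weight and of the Jacobi operator. -/

/-- Real constant matrices inside matrix polynomials, as a ring homomorphism. -/
noncomputable def constHom : Matrix (Fin 2) (Fin 2) ℝ →+* MatPoly 2 :=
  C.comp Complex.ofRealHom.mapMatrix

lemma scalarPoly_C_eq (r : ℝ) : (scalarPoly (C r) : MatPoly 2) = constHom !![r, 0; 0, r] := by
  rw [scalarPoly_C]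
  change _ = C _
  congr 1
  ext i j
  fin_cases i <;> fin_cases j <;> simp [Matrix.algebraMap_matrix_apply]

/-- The constant matrix in the leading coefficients of `𝒱` and `𝒩`. -/
noncomputable def matB (α β v : ℝ) : Matrix (Fin 2) (Fin 2) ℝ :=
  !![(β - α) / v, 1 + (β - α) / v; 1 + (α - β) / v, (α - β) / v]

/-- The term of order zero of `𝒱`. -/
noncomputable def matA (α β v : ℝ) : Matrix (Fin 2) (Fin 2) ℝ :=
  !![(v + 2 + α + β) / 2, 0; 0, (-v + 2 + α + β) / 2]

/-- The term of order zero of `𝒩`. -/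
noncomputable def matC (α β v : ℝ) : Matrix (Fin 2) (Fin 2) ℝ :=
  !![-(-v + 4 + α + β) / 2, 0; 0, -(α + β + v + 4) / 2]

/-- The positive diagonal matrix in the factorization of the weight. -/
noncomputable def matS (α β v : ℝ) : Matrix (Fin 2) (Fin 2) ℝ :=
  !![v * (v + 2 + α + β) / (4 * (v + α - β)), 0; 0, v * (-v + 2 + α + β) / (4 * (v - α + β))]

/-- Minus the eigenvalue of `𝒱𝒩` in terms of the Jacobi eigenvalue `y`. -/
noncomputable def eigMat (α β v y : ℝ) : Matrix (Fin 2) (Fin 2) ℝ :=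
  !![y + (v + 2 + α + β) / 2 * ((-v + 2 + α + β) / 2 + 1), 0;
     0, y + (-v + 2 + α + β) / 2 * ((v + 2 + α + β) / 2 + 1)]

/-- The matrix weight divided by the scalar Jacobi weight. -/
noncomputable def weightPoly (α β v : ℝ) : MatPoly 2 :=
  (X - constHom (matB α β v)) * constHom (matS α β v) * (X - constHom (matB α β v).transpose)

lemma adjPoly_constHom (A : Matrix (Fin 2) (Fin 2) ℝ) :
    adjPoly (constHom A) = constHom A.transpose := by
  change adjPoly (C _) = C _
  rw [adjPoly_C]
  congr 1
  ext i j
  simp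

lemma evalScalar_constHom (z : ℂ) (A : Matrix (Fin 2) (Fin 2) ℝ) :
    evalScalar z (constHom A) = A.map Complex.ofReal := evalScalar_C _ _

/-- The inequalities between the parameters, in linear form. -/
structure JacobiParams (α β v : ℝ) : Prop where
  hα : -1 < α
  hβ : -1 < β
  hv : v ≠ 0
  h1 : v + α - β ≠ 0
  h2 : v - α + β ≠ 0
  h3 : 0 < v + 2 + α + β
  h4 : 0 < -v + 2 + α + β

lemma JacobiParams.mk' {α β v : ℝ} (hv₁ : |α - β| < |v|) (hv₂ : |v| < α + β + 2) :
    JacobiParams α β v := by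
  have h := abs_lt.1 (hv₁.trans hv₂)
  have h' := abs_lt.1 hv₂
  refine ⟨by linarith, by linarith, ?_, ?_, ?_, by linarith, by linarith⟩
  · rintro rfl
    rw [abs_zero] at hv₁
    exact absurd (abs_nonneg (α - β)) (not_le.2 hv₁)
  · intro h0
    rw [show v = -(α - β) by linarith, abs_neg] at hv₁
    exact lt_irrefl _ hv₁
  · intro h0
    rw [show v = α - β by linarith] at hv₁
    exact lt_irrefl _ hv₁

section
variable {α β v : ℝ}

lemma JacobiParams.hs (h : JacobiParams α β v) : 0 < α + β + 2 := by linarith [h.hα, h.hβ]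

lemma JacobiParams.jacobiWeight_eq (h : JacobiParams α β v) (x : ℝ) :
    jacobiWeight α β v x = (jacobiDensity α β x : ℂ) • evalScalar (x : ℂ) (weightPoly α β v) := by
  have hx : Matrix.scalar (Fin 2) (x : ℂ) = (!![x, 0; 0, x] : Matrix _ _ ℝ).map Complex.ofReal := by
    ext i j; fin_cases i <;> fin_cases j <;> simp
  have hsub : ∀ A B : Matrix (Fin 2) (Fin 2) ℝ, A.map Complex.ofReal - B.map Complex.ofReal =
      (A - B).map Complex.ofReal := fun A B => by ext; simp
  have hmul : ∀ A B : Matrix (Fin 2) (Fin 2) ℝ, A.map Complex.ofReal * B.map Complex.ofReal =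
      (A * B).map Complex.ofReal := fun A B => (Matrix.map_mul (f := Complex.ofRealHom)).symm
  rw [weightPoly, map_mul, map_mul, map_sub, map_sub, evalScalar_constHom, evalScalar_constHom,
    evalScalar_constHom, evalScalar_X, hx, hsub, hsub, hmul, hmul]
  have hv := h.hv
  have h1 := h.h1
  have h2 := h.h2
  have key : (((1 - x) ^ 2 / 4) • !![v * (v + 2 + α + β) / (v + α - β), 0;
           0, v * (-v + 2 + α + β) / (v - α + β)]
      + ((1 - x) / 2) • !![-(v + α + β + 2), α + β + 2; α + β + 2, -(-v + α + β + 2)]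
      + !![α + 1, -α - 1; -α - 1, α + 1] : Matrix (Fin 2) (Fin 2) ℝ) =
      (!![x, 0; 0, x] - matB α β v) * matS α β v * (!![x, 0; 0, x] - (matB α β v).transpose) := by
    ext i j
    fin_cases i <;> fin_cases j <;>
    · simp [matB, matS, Matrix.mul_apply, Fin.sum_univ_two]
      field_simp
      ring
  rw [jacobiWeight, key]
  ext i j
  simp [jacobiDensity]

lemma act_opV (P : MatPoly 2) : RightOp.act P (opV α β v) =
    derivative P * (X + constHom (matB α β v)) + P * constHom (matA α β v) := rfl

lemma act_opN (P : MatPoly 2) : RightOp.act P (opN α β v) =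
    derivative P * (-X + constHom (matB α β v)) + P * constHom (matC α β v) := rfl

/-- The product of two first order operators. The terms `1 + 0` and `q * 0` match the unsimplified
output of the product rule. -/
lemma first_order_comp {R : Type*} [Ring R] (q q' q'' x A B K : R) :
    (q'' * (x + B) + q' * (1 + 0) + (q' * A + q * 0)) * (-x + B) + (q' * (x + B) + q * A) * K =
      q'' * (B * B - x ^ 2 + (x * B - B * x)) +
      q' * ((B + A * B + B * K) - (1 + A - K) * x + (x * K - K * x)) + q * (A * K) := by
  noncomm_ring

/-- The second order operator `𝒱𝒩` on scalar polynomials. -/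
lemma JacobiParams.act_opV_opN (h : JacobiParams α β v) (p : ℝ[X]) (y : ℝ)
    (hp : derivative (derivative p) * (1 - X ^ 2) +
      derivative p * (C (β - α) - C (α + β + 4) * X) = -(C y * p)) :
    RightOp.act (RightOp.act (scalarPoly p) (opV α β v)) (opN α β v) =
      -(constHom (eigMat α β v y) * scalarPoly p) := by
  have hv := h.hv
  -- The relations `hB`, `hAB` and `hAC` make the second and first order coefficients of `𝒱𝒩`
  -- scalar, equal to those of the Jacobi operator.
  have hB : matB α β v * matB α β v = 1 := by
    ext i j
    fin_cases i <;> fin_cases j <;>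
    · simp [matB]
      field_simp
      ring
  have hAB : matB α β v + matA α β v * matB α β v + matB α β v * matC α β v =
      !![β - α, 0; 0, β - α] := by
    ext i j
    fin_cases i <;> fin_cases j <;>
    · simp [matB, matA, matC]
      field_simp
      ring
  have hAC : 1 + matA α β v - matC α β v = !![α + β + 4, 0; 0, α + β + 4] := by
    ext i j
    fin_cases i <;> fin_cases j <;>
    · simp [matA, matC]
      try ring
  have hE : matA α β v * matC α β v = !![y, 0; 0, y] - eigMat α β v y := by
    ext i j
    fin_cases i <;> fin_cases j <;>
    · simp [matA, matC, eigMat]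
      try ring
  replace hB := congrArg constHom hB
  replace hAB := congrArg constHom hAB
  replace hAC := congrArg constHom hAC
  replace hE := congrArg constHom hE
  simp only [map_mul, map_add, map_sub, map_one] at hB hAB hAC hE
  replace hp := congrArg (scalarPoly : ℝ[X] →+* MatPoly 2) hp
  rw [map_add, map_mul, map_mul, map_sub scalarPoly 1, map_sub scalarPoly (C _), map_mul, map_neg,
    map_mul, map_one, map_pow, scalarPoly_X, scalarPoly_C_eq, scalarPoly_C_eq, scalarPoly_C_eq,
    ← scalarPoly_derivative, ← scalarPoly_derivative] at hp
  have hc := (scalarPoly_commute (N := 2) p (constHom (eigMat α β v y))).eq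
  have hcy := (scalarPoly_commute (N := 2) p (constHom !![y, 0; 0, y])).eq
  have hd : ∀ A, derivative (constHom A) = 0 := fun A => derivative_C
  rw [act_opN, act_opV, derivative_add, derivative_mul, derivative_mul, derivative_add,
    derivative_X, hd, hd, first_order_comp, hB, hAB, hAC, hE, X_mul, X_mul, sub_self, sub_self,
    add_zero, add_zero, ← hc, mul_sub (scalarPoly p), hcy, hp]
  abel

end

/-! ### Adjointness of the two factors and the orthogonal polynomials of `W`. -/

section
variable {α β v : ℝ}

/-- The difference of the two sides is quadratic in `x`, and `h0`, `h1`, `h2` say that its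
coefficients vanish. -/
lemma weight_ring_identity {R : Type*} [Ring R] {x A B B' S K c e g : R} (hxB' : Commute x B') (hxS : Commute x S) (hxK : Commute x K)
    (hxe : Commute x e) (hxc : Commute x c)
    (h2 : -(S * e) - S + A * S - S * K = 0) (h1 : S * c + S * B' * e - A * S * B' - A * B * S = 0)
    (h0 : -(S * B' * c) + S + A * B * S * B' + S * K = 0)  :
    S * (x - B') * (c - e * x) * g + (1 - x ^ 2) * S * g + A * ((x - B) * S * (x - B')) * g =
      -((1 - x ^ 2) * S * K * g) := by
  rw [← sub_eq_zero, sub_neg_eq_add]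
  have e1 : S * (x - B') * (c - e * x) + (1 - x ^ 2) * S + A * ((x - B) * S * (x - B')) +
      (1 - x ^ 2) * S * K = (-(S * B' * c) + S + A * B * S * B' + S * K) +
        (S * c + S * B' * e - A * S * B' - A * B * S) * x +
        (-(S * e) - S + A * S - S * K) * x ^ 2 := by
    simp only [pow_two, add_mul, mul_sub, sub_mul, neg_mul, one_mul, mul_assoc,
      hxB'.eq, hxS.eq, hxK.eq, hxc.eq, hxS.left_comm, hxK.left_comm, hxe.left_comm]
    abel
  rw [← add_mul, ← add_mul, ← add_mul, e1, h0, h1, h2]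
  simp

lemma matB_transpose : (matB α β v).transpose =
    !![(β - α) / v, 1 + (α - β) / v; 1 + (β - α) / v, (α - β) / v] := by
  ext i j; fin_cases i <;> fin_cases j <;> simp [matB]

/-- With `J` the scalar density, `w` the weight polynomial, and `A`, `K` the zero order terms of
`𝒱`, `𝒩`, this reads `(J (1 - x²) S (x - Bᵀ))' = -J (A w + (1 - x²) S K)`. It is the zero order
condition for `𝒱` and `𝒩` to be adjoint. -/
lemma JacobiParams.weight_identity (h : JacobiParams α β v) (G : MatPoly 2) :
    constHom (matS α β v) * (X - constHom (matB α β v).transpose) *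
        (constHom !![β - α, 0; 0, β - α] - constHom !![α + β + 2, 0; 0, α + β + 2] * X) * G +
      (1 - X ^ 2) * constHom (matS α β v) * G + constHom (matA α β v) * weightPoly α β v * G =
      -((1 - X ^ 2) * constHom (matS α β v) * constHom (matC α β v) * G) := by
  have hv := h.hv
  have h1 := h.h1
  have h2 := h.h2
  have hX : ∀ Q : MatPoly 2, Commute X Q := fun Q => X_mul
  have k2 : -(matS α β v * !![α + β + 2, 0; 0, α + β + 2]) - matS α β v + matA α β v * matS α β v
      - matS α β v * matC α β v = 0 := by
    ext i j
    fin_cases i <;> fin_cases j <;>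
    · simp [matA, matS, matC]
      try field_simp
      try ring
  have k1 : matS α β v * !![β - α, 0; 0, β - α] + matS α β v * (matB α β v).transpose *
      !![α + β + 2, 0; 0, α + β + 2] - matA α β v * matS α β v * (matB α β v).transpose
      - matA α β v * matB α β v * matS α β v = 0 := by
    rw [matB_transpose]
    ext i j
    fin_cases i <;> fin_cases j <;>
    · simp [matA, matS, matB]
      field_simp
      ring
  have k0 : -(matS α β v * (matB α β v).transpose * !![β - α, 0; 0, β - α]) + matS α β v
      + matA α β v * matB α β v * matS α β v * (matB α β v).transpose
      + matS α β v * matC α β v = 0 := by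
    rw [matB_transpose]
    ext i j
    fin_cases i <;> fin_cases j <;>
    · simp [matA, matS, matB, matC]
      field_simp
      ring
  replace k2 := congrArg constHom k2
  replace k1 := congrArg constHom k1
  replace k0 := congrArg constHom k0
  rw [map_zero] at k2 k1 k0
  simp only [map_mul, map_add, map_sub, map_neg] at k2 k1 k0
  exact weight_ring_identity (hX _) (hX _) (hX _) (hX _) (hX _) k2 k1 k0

/-- Since `(x + B)(x - B) = -(1 - x²)`, the term with `F'` acquires the factor `1 - x²` that
integration by parts requires. -/
lemma adjoint_ring_identity {R : Type*} [Ring R] {F F' x w A B B' S g : R}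
    (hB : B * B = 1) (hxB : x * B = B * x) (hw : w = 1 - x ^ 2) (hwc : ∀ Q, w * Q = Q * w) :
    (F' * (x + B) + F * A) * ((x - B) * S * (x - B')) * g =
      F * (A * ((x - B) * S * (x - B')) * g) - F' * (S * (x - B') * g) * w := by
  have e : (x + B) * (x - B) = -w := by
    rw [hw, add_mul, mul_sub, mul_sub, hxB, hB]; noncomm_ring
  have e' : (F' * (x + B) + F * A) * ((x - B) * S * (x - B')) * g =
      F' * (((x + B) * (x - B)) * (S * (x - B') * g)) + F * (A * ((x - B) * S * (x - B')) * g) := by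
    simp only [add_mul, mul_assoc]
  rw [e', e, neg_mul, hwc, mul_neg, ← mul_assoc F']
  abel

lemma adjoint_ring_identity' {R : Type*} [Ring R] {F x w z A B B' S K g g' : R}
    (hw : ∀ Q, w * Q = Q * w) (hz : ∀ Q, z * Q = Q * z)
    (hI : S * (x - B') * z * g + w * S * g + A * ((x - B) * S * (x - B')) * g =
      -(w * S * K * g)) :
    F * (S * (x - B') * g) * z + F * (S * g + S * (x - B') * g') * w
        + F * (A * ((x - B) * S * (x - B')) * g) =
      -(F * w * S * ((-x + B') * g' + K * g)) := by
  have e1 : F * (S * (x - B') * g) * z = F * (S * (x - B') * z * g) := by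
    rw [mul_assoc (S * (x - B')), hz]; simp only [mul_assoc]
  have e2 : F * (S * g + S * (x - B') * g') * w =
      F * (w * S * g) + F * w * S * ((x - B') * g') := by
    rw [mul_assoc F, ← hw]; noncomm_ring
  have e3 : F * (S * (x - B') * z * g) + F * (w * S * g) + F * (A * ((x - B) * S * (x - B')) * g) =
      -(F * w * S * (K * g)) := by
    rw [← mul_add, ← mul_add, hI]; noncomm_ring
  rw [e1, e2, ← add_assoc]
  rw [show F * (S * (x - B') * z * g) + F * (w * S * g) + F * w * S * ((x - B') * g') +
      F * (A * ((x - B) * S * (x - B')) * g) = F * (S * (x - B') * z * g) + F * (w * S * g) +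
      F * (A * ((x - B) * S * (x - B')) * g) + F * w * S * ((x - B') * g') by abel, e3]
  noncomm_ring

/-- Up to sign and a diagonal factor, `𝒩` is the adjoint of `𝒱`. -/
lemma JacobiParams.momentMap_act_opV (h : JacobiParams α β v) (F G : MatPoly 2) :
    momentMap (jacobiMoment α β) (RightOp.act F (opV α β v) * weightPoly α β v * adjPoly G) =
      -momentMap (jacobiMoment α β) (F * scalarPoly (1 - X ^ 2) * constHom (matS α β v) *
        adjPoly (RightOp.act G (opN α β v))) := by
  have hv := h.hv
  have hB : matB α β v * matB α β v = 1 := by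
    ext i j
    fin_cases i <;> fin_cases j <;>
    · simp [matB]
      field_simp
      ring
  replace hB := congrArg constHom hB
  rw [map_mul, map_one] at hB
  have hw : (scalarPoly (1 - X ^ 2) : MatPoly 2) = 1 - X ^ 2 := by
    rw [map_sub, map_one, map_pow, scalarPoly_X]
  have hc : ∀ Q : MatPoly 2, scalarPoly (1 - X ^ 2) * Q = Q * scalarPoly (1 - X ^ 2) :=
    fun Q => scalarPoly_commute _ Q
  have hd : ∀ A, derivative (constHom A) = 0 := fun A => derivative_C
  have hD : derivative (F * (constHom (matS α β v) * (X - constHom (matB α β v).transpose) *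
      adjPoly G)) = derivative F * (constHom (matS α β v) *
        (X - constHom (matB α β v).transpose) * adjPoly G) + F * (constHom (matS α β v) * adjPoly G
        + constHom (matS α β v) * (X - constHom (matB α β v).transpose) *
          derivative (adjPoly G)) := by
    rw [derivative_mul, derivative_mul, derivative_mul, derivative_sub, derivative_X, hd, hd,
      zero_mul, zero_add, sub_zero, mul_one]
  have hz : (scalarPoly (C (β - α) - C (α + β + 2) * X) : MatPoly 2) =
      constHom !![β - α, 0; 0, β - α] - constHom !![α + β + 2, 0; 0, α + β + 2] * X := by
    rw [map_sub scalarPoly (C _), map_mul, scalarPoly_X, scalarPoly_C_eq, scalarPoly_C_eq]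
  have hP := momentMap_pearson h.hα h.hβ (F * (constHom (matS α β v) *
    (X - constHom (matB α β v).transpose) * adjPoly G))
  have hI := h.weight_identity (adjPoly G)
  rw [← hw, ← hz, weightPoly] at hI
  have hCt : (matC α β v).transpose = matC α β v := by
    ext i j; fin_cases i <;> fin_cases j <;> simp [matC]
  rw [hD, add_mul, map_add, ← eq_sub_iff_add_eq] at hP
  rw [act_opV, act_opN, adjPoly_add, adjPoly_mul, adjPoly_mul, adjPoly_add, adjPoly_neg,
    adjPoly_X, adjPoly_constHom, adjPoly_constHom, adjPoly_derivative, weightPoly,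
    adjoint_ring_identity hB X_mul hw hc, map_sub, hP, hCt]
  have hJ := congrArg (momentMap (jacobiMoment α β)) (adjoint_ring_identity' (F := F)
    (g' := derivative (adjPoly G)) hc (fun Q => scalarPoly_commute _ Q) hI)
  rw [map_add, map_add, map_neg] at hJ
  rw [← hJ]
  abel

lemma adjPoly_scalarPoly {N : ℕ} (p : ℝ[X]) :
    adjPoly (scalarPoly p : MatPoly N) = scalarPoly p := by
  ext k i j
  rw [adjPoly_coeff, scalarPoly_coeff]
  simp only [Matrix.algebraMap_matrix_apply, Matrix.conjTranspose_apply]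
  by_cases h : i = j
  · simp [h]
  · simp [h, Ne.symm h]

/-- The matrix-valued Jacobi-type polynomials, obtained from the scalar ones by `𝒱`. -/
noncomputable def matJacobi (α β v : ℝ) (n : ℕ) : MatPoly 2 :=
  RightOp.act (scalarPoly (jacobiPoly α β n)) (opV α β v)

lemma JacobiParams.matJacobi_act_opN (h : JacobiParams α β v) (n : ℕ) :
    RightOp.act (matJacobi α β v n) (opN α β v) =
      -(constHom (eigMat α β v (jacobiEig α β n)) * scalarPoly (jacobiPoly α β n)) :=
  h.act_opV_opN _ _ (jacobiPoly_ode h.hα n)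

lemma matJacobi_coeff (n k : ℕ) : (matJacobi α β v n).coeff k =
    ((jacobiPoly α β n).coeff k • (!![(k : ℝ), 0; 0, k] + matA α β v) +
      ((jacobiPoly α β n).coeff (k + 1) * (k + 1)) • matB α β v).map Complex.ofReal := by
  have hC : ∀ A, constHom A = C (A.map Complex.ofReal) := fun _ => rfl
  rw [matJacobi, act_opV, mul_add, hC, hC, coeff_add, coeff_add, coeff_mul_C, coeff_mul_C,
    scalarPoly_derivative, scalarPoly_coeff, scalarPoly_coeff, coeff_derivative,
    ← Algebra.smul_def, ← Algebra.smul_def]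
  have hX : (scalarPoly (derivative (jacobiPoly α β n)) * X : MatPoly 2).coeff k =
      algebraMap ℝ _ ((jacobiPoly α β n).coeff k * k) := by
    rcases k with _ | k
    · simp
    · rw [coeff_mul_X, scalarPoly_coeff, coeff_derivative]; push_cast; rfl
  rw [hX, Algebra.algebraMap_eq_smul_one]
  ext i j
  fin_cases i <;> fin_cases j <;> simp [matA, matB] <;> ring

/-- The leading coefficient is that of `p_n` times `n + A`, whose diagonal entries `n + (±v + 2 + α
+ β)/2` are positive. -/
lemma JacobiParams.isSimpleSeq (h : JacobiParams α β v) : IsSimpleSeq (matJacobi α β v) := by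
  intro n
  have h3 := h.h3
  have h4 := h.h4
  have hn := n.cast_nonneg (α := ℝ)
  have hc0 := jacobiPoly_coeff_ne_zero h.hα h.hs n
  have hz : ∀ k, n < k → (jacobiPoly α β n).coeff k = 0 := fun k hk =>
    coeff_eq_zero_of_natDegree_lt (by rwa [jacobiPoly_natDegree h.hα h.hs])
  have hu : IsUnit ((matJacobi α β v n).coeff n) := by
    rw [Matrix.isUnit_iff_isUnit_det, isUnit_iff_ne_zero, matJacobi_coeff, hz (n + 1) (by omega),
      zero_mul, zero_smul, add_zero, show (Complex.ofReal : ℝ → ℂ) = Complex.ofRealHom from rfl,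
      ← RingHom.mapMatrix_apply, ← RingHom.map_det, Complex.ofRealHom_eq_coe, Ne,
      Complex.ofReal_eq_zero, Matrix.det_smul]
    refine mul_ne_zero (pow_ne_zero _ hc0) ?_
    simp only [matA, Matrix.det_fin_two, Matrix.add_apply, Matrix.of_apply, Matrix.cons_val',
      Matrix.cons_val_zero, Matrix.cons_val_one, Matrix.cons_val_fin_one, add_zero, mul_zero,
      sub_zero]
    exact mul_ne_zero (by linarith) (by linarith)
  have hd : (matJacobi α β v n).natDegree = n := by
    refine natDegree_eq_of_le_of_coeff_ne_zero ?_ hu.ne_zero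
    rw [natDegree_le_iff_coeff_eq_zero]
    intro k hk
    rw [matJacobi_coeff, hz k hk, hz (k + 1) (by omega)]
    ext; simp
  exact ⟨hd, by rw [leadingCoeff, hd]; exact hu⟩

lemma JacobiParams.weightForm_eq (h : JacobiParams α β v) (P Q : MatPoly 2) :
    weightForm (Set.Ioo (-1) 1) (jacobiWeight α β v) P Q =
      momentMap (jacobiMoment α β) (P * weightPoly α β v * adjPoly Q) :=
  weightForm_eq_momentMap h.hα h.hβ h.jacobiWeight_eq P Q

/-- Moving `𝒱` across as `-𝒩` and using `p_m 𝒱𝒩 = -E(y_m) p_m` reduces the form to scalar Jacobi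
orthogonality for the density multiplied by `1 - x²`. -/
lemma JacobiParams.weightForm_matJacobi (h : JacobiParams α β v) (n m : ℕ) :
    weightForm (Set.Ioo (-1) 1) (jacobiWeight α β v) (matJacobi α β v n) (matJacobi α β v m) =
      (∫ x in Set.Ioo (-1 : ℝ) 1, jacobiDensity α β x *
        ((1 - X ^ 2) * jacobiPoly α β n * jacobiPoly α β m).eval x) •
        (matS α β v * eigMat α β v (jacobiEig α β m)).map Complex.ofReal := by
  have hE : (eigMat α β v (jacobiEig α β m)).transpose = eigMat α β v (jacobiEig α β m) := by
    ext i j; fin_cases i <;> fin_cases j <;> simp [eigMat]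
  have e : scalarPoly (jacobiPoly α β n) * scalarPoly (1 - X ^ 2) * constHom (matS α β v) *
      (scalarPoly (jacobiPoly α β m) * constHom (eigMat α β v (jacobiEig α β m))) =
      scalarPoly ((1 - X ^ 2) * jacobiPoly α β n * jacobiPoly α β m) *
        C ((matS α β v * eigMat α β v (jacobiEig α β m)).map Complex.ofReal) := by
    change _ = _ * constHom _
    rw [mul_assoc _ (constHom (matS α β v)), ← mul_assoc (constHom (matS α β v)),
      ← (scalarPoly_commute _ (constHom (matS α β v))).eq, map_mul constHom, map_mul scalarPoly,
      map_mul scalarPoly, (scalarPoly_commute (1 - X ^ 2) (scalarPoly (jacobiPoly α β n))).eq]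
    simp only [mul_assoc]
  have hneg : ∀ P Q : MatPoly 2, P * -Q = -(P * Q) := fun P Q => mul_neg P Q
  rw [h.weightForm_eq, matJacobi, h.momentMap_act_opV, h.matJacobi_act_opN, adjPoly_neg,
    adjPoly_mul, adjPoly_scalarPoly, adjPoly_constHom, hE, hneg, map_neg, neg_neg, e,
    momentMap_mul_C, momentMap_scalarPoly h.hα h.hβ, ← Algebra.smul_def]

lemma JacobiParams.weightForm_orthogonal (h : JacobiParams α β v) (n m : ℕ) (hnm : n ≠ m) :
    weightForm (Set.Ioo (-1) 1) (jacobiWeight α β v) (matJacobi α β v n) (matJacobi α β v m) = 0 := by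
  rw [h.weightForm_matJacobi, jacobiPoly_orthogonal h.hα h.hβ hnm, zero_smul]

lemma JacobiParams.isOrthogonalSeq (h : JacobiParams α β v) :
    IsOrthogonalSeq (Set.Ioo (-1) 1) (jacobiWeight α β v) (matJacobi α β v) :=
  ⟨h.isSimpleSeq, h.weightForm_orthogonal⟩

lemma JacobiParams.weightForm_isUnit (h : JacobiParams α β v) (n : ℕ) :
    IsUnit (weightForm (Set.Ioo (-1) 1) (jacobiWeight α β v)
      (matJacobi α β v n) (matJacobi α β v n)) := by
  have h0 : jacobiPoly α β n ≠ 0 := fun h0 =>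
    jacobiPoly_coeff_ne_zero h.hα h.hs n (by rw [h0, coeff_zero])
  have hpos := integral_jacobiDensity_pos h.hα h.hβ h0
  have hE : 0 ≤ jacobiEig α β n := mul_nonneg n.cast_nonneg (by
    have := n.cast_nonneg (α := ℝ); linarith [h.hs])
  have h3 := h.h3
  have h4 := h.h4
  rw [h.weightForm_matJacobi, Matrix.isUnit_iff_isUnit_det, isUnit_iff_ne_zero]
  generalize (∫ x in Set.Ioo (-1 : ℝ) 1, jacobiDensity α β x *
    ((1 - X ^ 2) * jacobiPoly α β n * jacobiPoly α β n).eval x) = κ at *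
  have e : κ • (matS α β v * eigMat α β v (jacobiEig α β n)).map Complex.ofReal =
      (κ • (matS α β v * eigMat α β v (jacobiEig α β n))).map Complex.ofReal := by
    ext; simp
  rw [e, show (Complex.ofReal : ℝ → ℂ) = Complex.ofRealHom from rfl, ← RingHom.mapMatrix_apply,
    ← RingHom.map_det, Complex.ofRealHom_eq_coe, Ne, Complex.ofReal_eq_zero, Matrix.det_smul,
    Matrix.det_mul, matS, eigMat, Matrix.det_fin_two_of, Matrix.det_fin_two_of, mul_zero, sub_zero,
    sub_zero]
  have hv := h.hv
  have h1 := h.h1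
  have h2 := h.h2
  have g1 : 0 < (v + 2 + α + β) / 2 * ((-v + 2 + α + β) / 2 + 1) := by
    apply mul_pos <;> linarith
  have g2 : 0 < (-v + 2 + α + β) / 2 * ((v + 2 + α + β) / 2 + 1) := by
    apply mul_pos <;> linarith
  refine mul_ne_zero (pow_ne_zero _ hpos.ne') (mul_ne_zero (mul_ne_zero ?_ ?_)
    (mul_ne_zero (by linarith) (by linarith)))
  · exact div_ne_zero (mul_ne_zero hv h3.ne') (mul_ne_zero four_ne_zero h1)
  · exact div_ne_zero (mul_ne_zero hv h4.ne') (mul_ne_zero four_ne_zero h2)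

/-- Membership in `𝒟(W)` can be tested on one explicit sequence of orthogonal polynomials. -/
lemma JacobiParams.mem_jacobiAlg_iff (h : JacobiParams α β v) {D : RightOp 2} :
    D ∈ jacobiAlg α β v ↔ IsMatDiffOp D ∧ ∃ Λ : ℕ → Matrix (Fin 2) (Fin 2) ℂ,
      ∀ n, RightOp.act (matJacobi α β v n) D = C (Λ n) * matJacobi α β v n := by
  constructor
  · rintro ⟨hD, hD'⟩
    exact ⟨hD, Classical.axiomOfChoice (hD' _ h.isOrthogonalSeq)⟩
  · rintro ⟨hD, Λ, hΛ⟩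
    refine ⟨hD, fun P hP n => ?_⟩
    have hfC : ∀ (A : Matrix (Fin 2) (Fin 2) ℂ) R S,
        weightForm (Set.Ioo (-1) 1) (jacobiWeight α β v) R (C A * S) =
          weightForm (Set.Ioo (-1) 1) (jacobiWeight α β v) R S * A.conjTranspose := by
      intro A R S
      rw [h.weightForm_eq, h.weightForm_eq, adjPoly_mul, adjPoly_C, ← mul_assoc, momentMap_mul_C]
    have hK : ∀ n, ∃ K, P n = C K * matJacobi α β v n := by
      refine IsSimpleSeq.eq_C_mul_of_orthogonal hP.1 h.isSimpleSeq
        (weightForm (Set.Ioo (-1) 1) (jacobiWeight α β v)) ?_ ?_ ?_ hfC hP.2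
        h.weightForm_orthogonal h.weightForm_isUnit
      · intro R S T
        rw [h.weightForm_eq, h.weightForm_eq, h.weightForm_eq, add_mul, add_mul, map_add]
      · intro R S T
        rw [h.weightForm_eq, h.weightForm_eq, h.weightForm_eq, adjPoly_add, mul_add, map_add]
      · intro A R S
        rw [h.weightForm_eq, h.weightForm_eq, mul_assoc (C A), mul_assoc (C A), momentMap_C_mul]
    obtain ⟨K, hK⟩ := hK n
    -- Passing to another orthogonal sequence conjugates the eigenvalue by the invertible factor
    -- `K`.
    obtain ⟨L, hL⟩ : ∃ L, L * K = K * Λ n := by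
      have hu : IsUnit K := by
        have h1 := (hP.1 n).2
        have h2 : (P n).leadingCoeff = K * (matJacobi α β v n).coeff n := by
          rw [leadingCoeff, (hP.1 n).1, hK, coeff_C_mul]
        rw [h2, Matrix.isUnit_iff_isUnit_det, Matrix.det_mul] at h1
        exact (Matrix.isUnit_iff_isUnit_det _).2 (isUnit_of_mul_isUnit_left h1)
      obtain ⟨u, rfl⟩ := hu
      exact ⟨(u : Matrix (Fin 2) (Fin 2) ℂ) * Λ n * (↑u⁻¹ : Matrix (Fin 2) (Fin 2) ℂ), by rw [mul_assoc, Units.inv_mul, mul_one]⟩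
    exact ⟨L, by rw [hK, hD.act_C_mul, hΛ, ← mul_assoc, ← mul_assoc, ← C_mul, ← C_mul, hL]⟩

end

/-! ### Eigenvalues are polynomials in the Jacobi eigenvalue. -/

lemma opV_isMatDiffOp (α β v : ℝ) : IsMatDiffOp (opV α β v) :=
  (dTerm_isMatDiffOp _ _).add (dTerm_isMatDiffOp _ _)

lemma opN_isMatDiffOp (α β v : ℝ) : IsMatDiffOp (opN α β v) :=
  (dTerm_isMatDiffOp _ _).add (dTerm_isMatDiffOp _ _)

/-- The constants in the diagonal entries `y + c` of `eigMat`. -/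
noncomputable def eigShift (α β v : ℝ) : Fin 2 → ℝ :=
  ![(v + 2 + α + β) / 2 * ((-v + 2 + α + β) / 2 + 1),
    (-v + 2 + α + β) / 2 * ((v + 2 + α + β) / 2 + 1)]

lemma eigMat_map (α β v y : ℝ) : (eigMat α β v y).map Complex.ofReal =
    Matrix.diagonal fun i => ((y : ℂ) + eigShift α β v i) := by
  ext i j
  fin_cases i <;> fin_cases j <;> simp [eigMat, eigShift]

section
variable {α β v : ℝ}

/-- `𝒩` sends `P_n` to `-E(y_n) p_n`, the constant `M` passes through the scalar `p_n`, and `𝒱`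
restores `P_n`. -/
lemma JacobiParams.act_opN_mul_opV (h : JacobiParams α β v) (M : Matrix (Fin 2) (Fin 2) ℝ)
    (n : ℕ) :
    RightOp.act (matJacobi α β v n) (opN α β v * dTerm 0 (constMat M) * opV α β v) =
      C (-(Matrix.diagonal fun i => ((jacobiEig α β n : ℂ) + eigShift α β v i)) *
        M.map Complex.ofReal) * matJacobi α β v n := by
  have hE : constHom (eigMat α β v (jacobiEig α β n)) =
      C (Matrix.diagonal fun i => ((jacobiEig α β n : ℂ) + eigShift α β v i)) := by
    rw [← eigMat_map]; rfl
  have hneg : ∀ P Q : MatPoly 2, -(P * Q) = -P * Q := fun P Q => (neg_mul P Q).symm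
  rw [act_mul, act_mul, h.matJacobi_act_opN, hE, dTerm_act, Function.iterate_zero, id,
    hneg, mul_assoc, (scalarPoly_commute _ (constMat M)).eq, ← mul_assoc, ← C_neg]
  change RightOp.act (C _ * C _ * _) _ = _
  rw [← C_mul, (opV_isMatDiffOp α β v).act_C_mul]
  rfl

lemma scalarPoly_iterate_derivative {N : ℕ} (p : ℝ[X]) (k : ℕ) :
    derivative^[k] (scalarPoly p : MatPoly N) = scalarPoly (derivative^[k] p) := by
  induction k with
  | zero => rfl
  | succ k ih =>
    rw [Function.iterate_succ_apply', ih, scalarPoly_derivative, Function.iterate_succ_apply']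

lemma iterate_derivative_X_pow_matPoly {N : ℕ} (n k : ℕ) :
    derivative^[k] (X ^ n : MatPoly N) = n.descFactorial k • X ^ (n - k) := by
  rw [← scalarPoly_X, ← map_pow, scalarPoly_iterate_derivative,
    iterate_derivative_X_pow_eq_natCast_mul, map_mul, map_natCast, map_pow, nsmul_eq_mul]

lemma evalScalar_one_scalarPoly {N : ℕ} (p : ℝ[X]) :
    evalScalar 1 (scalarPoly p : MatPoly N) = algebraMap ℝ _ (p.eval 1) := by
  rw [evalScalar_apply, scalarPoly, coe_mapRingHom, map_one, eval_one_map]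

/-- The values at `1` of a differential operator on the Jacobi polynomials are polynomials in the
eigenvalue. -/
lemma IsMatDiffOp.evalScalar_one_act_jacobiPoly {D : RightOp 2} (hD : IsMatDiffOp D) (α β : ℝ) :
    ∃ Q : Fin 2 → Fin 2 → ℂ[X], ∀ n i j,
      evalScalar 1 (RightOp.act (scalarPoly (jacobiPoly α β n)) D) i j =
        (Q i j).eval (jacobiEig α β n : ℂ) := by
  obtain ⟨m, F, rfl⟩ := hD
  refine ⟨fun i j => ∑ k ∈ Finset.range (m + 1),
    (C (k.factorial : ℝ) * jacobiTaylor α β k).map Complex.ofRealHom *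
      C (evalScalar 1 (F k) i j), fun n i j => ?_⟩
  have hmap : ∀ (p : ℝ[X]) (y : ℝ), (p.map Complex.ofRealHom).eval (y : ℂ) = p.eval y :=
    fun p y => eval_map_apply Complex.ofRealHom y
  rw [act_sum, map_sum, Matrix.sum_apply, eval_finsetSum]
  refine Finset.sum_congr rfl fun k _ => ?_
  rw [eval_mul (p := map _ _), hmap, eval_C, dTerm_act, scalarPoly_iterate_derivative, map_mul, evalScalar_one_scalarPoly,
    jacobiPoly_iterate_derivative_eval_one, ← Algebra.smul_def, Matrix.smul_apply,
    Complex.real_smul]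

lemma jacobiPoly_eval_one (n : ℕ) : (jacobiPoly α β n).eval 1 = 1 := by
  have := jacobiPoly_iterate_derivative_eval_one α β n 0
  simpa [jacobiTaylor] using this

lemma jacobiPoly_derivative_eval_one (n : ℕ) :
    (derivative (jacobiPoly α β n)).eval 1 = jacobiEig α β n / 2 / (α + 2) := by
  have := jacobiPoly_iterate_derivative_eval_one α β n 1
  rw [Function.iterate_one] at this
  rw [this]
  simp [jacobiTaylor, jacobiEig]
  ring

lemma matJacobi_evalScalar_one (n : ℕ) : evalScalar 1 (matJacobi α β v n) =
    ((jacobiEig α β n / 2 / (α + 2)) • (1 + matB α β v) + matA α β v).map Complex.ofReal := by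
  rw [matJacobi, act_opV, map_add, map_mul, map_mul, map_add, evalScalar_X, evalScalar_constHom,
    evalScalar_constHom, scalarPoly_derivative, evalScalar_one_scalarPoly,
    evalScalar_one_scalarPoly, jacobiPoly_eval_one, jacobiPoly_derivative_eval_one, map_one,
    map_one, one_mul, ← Algebra.smul_def]
  ext i j
  fin_cases i <;> fin_cases j <;> simp [matA, matB, mul_add]

/-- The eigenvalues of an operator in `𝒟(W)` are polynomials in the Jacobi eigenvalue. -/
lemma JacobiParams.eigenvalue_polynomial (h : JacobiParams α β v) {D : RightOp 2}
    (hD : IsMatDiffOp D) {Λ : ℕ → Matrix (Fin 2) (Fin 2) ℂ}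
    (hΛ : ∀ n, RightOp.act (matJacobi α β v n) D = C (Λ n) * matJacobi α β v n) :
    ∃ R : Fin 2 → Fin 2 → ℂ[X], ∀ n i j, Λ n i j = (R i j).eval (jacobiEig α β n : ℂ) := by
  -- At `x = 1`, `p_n 𝒱D𝒩` gives `-Λ_n E(y_n)` and `p_n 𝒱D` gives `Λ_n P_n(1)`. Both are polynomial
  -- in `y_n`, and together they determine `Λ_n` polynomially.
  obtain ⟨Q₁, hQ₁⟩ := (((opV_isMatDiffOp α β v).mul hD).mul
    (opN_isMatDiffOp α β v)).evalScalar_one_act_jacobiPoly α β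
  obtain ⟨Q₂, hQ₂⟩ := ((opV_isMatDiffOp α β v).mul hD).evalScalar_one_act_jacobiPoly α β
  have e₁ : ∀ n i j, -(Λ n i j * ((jacobiEig α β n : ℂ) + eigShift α β v j)) =
      (Q₁ i j).eval (jacobiEig α β n : ℂ) := by
    intro n i j
    rw [← hQ₁, act_mul, act_mul, ← matJacobi, hΛ, (opN_isMatDiffOp α β v).act_C_mul,
      h.matJacobi_act_opN, map_mul, map_neg, map_mul, evalScalar_C, evalScalar_constHom,
      evalScalar_one_scalarPoly, jacobiPoly_eval_one, map_one, mul_one, eigMat_map, mul_neg,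
      Matrix.neg_apply, Matrix.mul_diagonal]
  have e₂ : ∀ n i j, (Λ n * ((jacobiEig α β n / 2 / (α + 2)) • (1 + matB α β v) +
      matA α β v).map Complex.ofReal) i j = (Q₂ i j).eval (jacobiEig α β n : ℂ) := by
    intro n i j
    rw [← hQ₂, act_mul, ← matJacobi, hΛ, map_mul, evalScalar_C, matJacobi_evalScalar_one]
  have hα2 : (α : ℂ) + 2 ≠ 0 := by
    have : α + 2 ≠ 0 := by linarith [h.hα]
    exact_mod_cast this
  have hv : (v : ℂ) ≠ 0 := by exact_mod_cast h.hv
  have hx1 : (v : ℂ) + α - β ≠ 0 := by exact_mod_cast h.h1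
  have hx2 : (v : ℂ) - α + β ≠ 0 := by exact_mod_cast h.h2
  have hx3 : (v : ℂ) + 2 + α + β ≠ 0 := by exact_mod_cast h.h3.ne'
  have hx4 : -(v : ℂ) + 2 + α + β ≠ 0 := by exact_mod_cast h.h4.ne'
  obtain ⟨G, hG⟩ : ∃ G : Fin 2 → Fin 2 → ℂ[X], ∀ (y : ℝ) i j,
      (((y / 2 / (α + 2)) • (1 + matB α β v) + matA α β v).map Complex.ofReal).adjugate i j =
        (G i j).eval (y : ℂ) := by
    refine ⟨fun i j => C ((2 : ℂ)⁻¹ * ((α : ℂ) + 2)⁻¹ *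
      ((1 + matB α β v).adjugate i j : ℝ)) * X + C ((matA α β v).adjugate i j : ℂ),
      fun y i j => ?_⟩
    fin_cases i <;> fin_cases j <;>
    · simp [Matrix.adjugate_fin_two]
      ring
  -- The determinant of `P_n(1)` is only affine in `y` because `1 + B` is singular.
  have hdet : ∀ y : ℝ, (((y / 2 / (α + 2)) • (1 + matB α β v) + matA α β v).map
      Complex.ofReal).det = (α + 1) / (α + 2) * y +
        (v + 2 + α + β) / 2 * ((-v + 2 + α + β) / 2) := by
    intro y
    rw [Matrix.det_fin_two]
    simp [matA, matB]
    field_simp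
    ring
  have e₃ : ∀ n i j, Λ n i j * ((α + 1) / (α + 2) * (jacobiEig α β n : ℂ) +
      (v + 2 + α + β) / 2 * ((-v + 2 + α + β) / 2)) =
        (∑ k, Q₂ i k * G k j).eval (jacobiEig α β n : ℂ) := by
    intro n i j
    rw [← hdet, eval_finsetSum]
    simp only [eval_mul, ← hG, ← e₂]
    rw [← Matrix.mul_apply, mul_assoc, Matrix.mul_adjugate, mul_smul_comm, mul_one,
      Matrix.smul_apply, smul_eq_mul, mul_comm]
  -- This constant is a combination of `det P_n(1)` and `y + c_j`; as it is nonzero, `Λ_n` is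
  -- recovered from its products with these two by a Bézout relation.
  have hδ : ∀ j, (v + 2 + α + β) / 2 * ((-v + 2 + α + β) / 2) -
      (α + 1) / (α + 2) * (eigShift α β v j : ℂ) ≠ 0 := by
    intro j
    fin_cases j
    · have : (v + 2 + α + β) / 2 * ((-v + 2 + α + β) / 2) -
          (α + 1) / (α + 2) * (eigShift α β v 0 : ℂ) =
          -((v + 2 + α + β) * (v + α - β)) / (4 * (α + 2)) := by
        simp [eigShift]; field_simp; ring
      exact this ▸ div_ne_zero (neg_ne_zero.2 (mul_ne_zero hx3 hx1))
        (mul_ne_zero (by norm_num : (4 : ℂ) ≠ 0) hα2)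
    · have : (v + 2 + α + β) / 2 * ((-v + 2 + α + β) / 2) -
          (α + 1) / (α + 2) * (eigShift α β v 1 : ℂ) =
          ((-v + 2 + α + β) * (v - α + β)) / (4 * (α + 2)) := by
        simp [eigShift]; field_simp; ring
      exact this ▸ div_ne_zero (mul_ne_zero hx4 hx2) (mul_ne_zero (by norm_num : (4 : ℂ) ≠ 0) hα2)
  refine ⟨fun i j => C ((v + 2 + α + β) / 2 * ((-v + 2 + α + β) / 2) -
    (α + 1) / (α + 2) * (eigShift α β v j : ℂ))⁻¹ *
      (∑ k, Q₂ i k * G k j + C (((α : ℂ) + 1) / (α + 2)) * Q₁ i j), fun n i j => ?_⟩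
  rw [eval_mul, eval_C, eval_add, eval_mul, eval_C, ← e₃, ← e₁, eq_inv_mul_iff_mul_eq₀ (hδ j)]
  ring

/-- The coefficients of `Xⁿ · D` at a fixed distance from `n` are polynomials in `n`. -/
lemma IsMatDiffOp.coeff_act_X_pow {N : ℕ} {D : RightOp N} (hD : IsMatDiffOp D) (d : ℕ) :
    ∃ T : Fin N → Fin N → ℂ[X], ∀ (n : ℕ) i j,
      (RightOp.act (X ^ (n + d)) D).coeff n i j = (T i j).eval ((n + d : ℕ) : ℂ) := by
  obtain ⟨m, F, rfl⟩ := hD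
  refine ⟨fun i j => ∑ k ∈ Finset.range (m + 1), descPochhammer ℂ k *
    C (if d ≤ k then (F k).coeff (k - d) i j else 0), fun n i j => ?_⟩
  rw [act_sum, finsetSum_coeff, Matrix.sum_apply, eval_finsetSum]
  refine Finset.sum_congr rfl fun k _ => ?_
  rw [dTerm_act, iterate_derivative_X_pow_matPoly, eval_mul, eval_C,
    descPochhammer_eval_eq_descFactorial, smul_mul_assoc, coeff_smul, Matrix.smul_apply,
    nsmul_eq_mul]
  -- When `n + d < k` the falling factorial vanishes, which disposes of the truncated exponent.
  rcases Nat.lt_or_ge (n + d) k with hk | hk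
  · rw [Nat.descFactorial_of_lt hk, Nat.cast_zero, zero_mul, zero_mul]
  congr 1
  rw [coeff_X_pow_mul']
  by_cases hd : d ≤ k
  · rw [if_pos hd, if_pos (by omega), show n - (n + d - k) = k - d by omega]
  · rw [if_neg hd, if_neg (by omega), Matrix.zero_apply]

lemma Polynomial.eq_of_eval_natCast_eq {p q : ℂ[X]} (h : ∀ n : ℕ, p.eval (n : ℂ) = q.eval (n : ℂ)) :
    p = q :=
  eq_of_infinite_eval_eq p q ((Set.infinite_range_of_injective Nat.cast_injective).mono
    (by rintro _ ⟨n, rfl⟩; exact h n))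

/-- The top two coefficients of `P · D` when `D` does not raise degrees. -/
lemma IsMatDiffOp.coeff_act_top {N : ℕ} {D : RightOp N} (hD : IsMatDiffOp D)
    (hdeg : ∀ (n : ℕ) (Q : MatPoly N), (∀ k, n ≤ k → Q.coeff k = 0) →
      ∀ j, n ≤ j → (RightOp.act Q D).coeff j = 0) (n : ℕ) {P : MatPoly N}
    (hP : ∀ k, n < k → P.coeff k = 0) :
    (RightOp.act P D).coeff n = P.coeff n * (RightOp.act (X ^ n) D).coeff n := by
  have h : P = C (P.coeff n) * X ^ n + (P - C (P.coeff n) * X ^ n) := by abel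
  have h0 := hdeg n (P - C (P.coeff n) * X ^ n) (fun k hk => by
    rw [coeff_sub, coeff_C_mul, coeff_X_pow]
    rcases hk.eq_or_lt with rfl | hk
    · simp
    · rw [hP k hk, if_neg hk.ne', mul_zero, sub_zero]) n le_rfl
  rw [h, add_act, coeff_add, h0, add_zero, hD.act_C_mul, coeff_C_mul, ← h]

lemma IsMatDiffOp.coeff_act_subtop {N : ℕ} {D : RightOp N} (hD : IsMatDiffOp D)
    (hdeg : ∀ (n : ℕ) (Q : MatPoly N), (∀ k, n ≤ k → Q.coeff k = 0) →
      ∀ j, n ≤ j → (RightOp.act Q D).coeff j = 0) (n : ℕ) {P : MatPoly N}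
    (hP : ∀ k, n + 1 < k → P.coeff k = 0) :
    (RightOp.act P D).coeff n = P.coeff (n + 1) * (RightOp.act (X ^ (n + 1)) D).coeff n +
      P.coeff n * (RightOp.act (X ^ n) D).coeff n := by
  have h : P = C (P.coeff (n + 1)) * X ^ (n + 1) + (P - C (P.coeff (n + 1)) * X ^ (n + 1)) := by
    abel
  have h0 := hD.coeff_act_top hdeg n (P := P - C (P.coeff (n + 1)) * X ^ (n + 1)) (fun k hk => by
    rw [coeff_sub, coeff_C_mul, coeff_X_pow]
    rcases (Nat.succ_le_of_lt hk).eq_or_lt with rfl | hk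
    · simp
    · rw [hP k hk, if_neg hk.ne', mul_zero, sub_zero])
  have h1 : (P - C (P.coeff (n + 1)) * X ^ (n + 1)).coeff n = P.coeff n := by
    rw [coeff_sub, coeff_C_mul, coeff_X_pow, if_neg (by omega), mul_zero, sub_zero]
  rw [h1] at h0
  conv_lhs => rw [h]
  rw [add_act, coeff_add, h0, hD.act_C_mul, coeff_C_mul]

end

/-! ### Constraints on eigenvalues from the two top coefficients. -/

section
variable {α β v : ℝ}

/-- The eigenvalues of an operator in `𝒟(W)`, up to a scalar, are divisible on the left by the
eigenvalues of `𝒱𝒩`. -/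
lemma JacobiParams.eigenvalue_structure (h : JacobiParams α β v) {D : RightOp 2}
    (hD : IsMatDiffOp D) {Λ : ℕ → Matrix (Fin 2) (Fin 2) ℂ}
    (hΛ : ∀ n, RightOp.act (matJacobi α β v n) D = C (Λ n) * matJacobi α β v n) :
    ∃ (c : ℂ) (f : Fin 2 → Fin 2 → ℂ[X]), ∀ n i j, Λ n i j = (if i = j then c else 0) +
      ((jacobiEig α β n : ℂ) + eigShift α β v i) * (f i j).eval (jacobiEig α β n : ℂ) := by
  obtain ⟨R, hR⟩ := h.eigenvalue_polynomial hD hΛ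
  obtain ⟨T, hT⟩ := hD.coeff_act_X_pow 0
  obtain ⟨U, hU⟩ := hD.coeff_act_X_pow 1
  have hdeg : ∀ (n : ℕ) (Q : MatPoly 2), (∀ k, n ≤ k → Q.coeff k = 0) →
      ∀ j, n ≤ j → (RightOp.act Q D).coeff j = 0 := fun n Q hQ =>
    h.isSimpleSeq.coeff_act_eq_zero hD hΛ hQ
  have hv : (v : ℂ) ≠ 0 := by exact_mod_cast h.hv
  have hx2 : (v : ℂ) - α + β ≠ 0 := by exact_mod_cast h.h2
  have hx3 : (v : ℂ) + 2 + α + β ≠ 0 := by exact_mod_cast h.h3.ne'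
  obtain ⟨a₁, ha₁⟩ : ∃ a : ℂ, a = (v + 2 + α + β) / 2 := ⟨_, rfl⟩
  obtain ⟨a₂, ha₂⟩ : ∃ a : ℂ, a = (-v + 2 + α + β) / 2 := ⟨_, rfl⟩
  have hc0 : ((eigShift α β v 0 : ℝ) : ℂ) = a₁ * (a₂ + 1) := by
    rw [ha₁, ha₂]; simp [eigShift]
  have hc1 : ((eigShift α β v 1 : ℝ) : ℂ) = a₂ * (a₁ + 1) := by
    rw [ha₁, ha₂]; simp [eigShift]
  have hρ : ∀ n, ((jacobiPoly α β n).coeff n : ℂ) ≠ 0 := fun n => by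
    exact_mod_cast jacobiPoly_coeff_ne_zero h.hα h.hs n
  have hzero : ∀ n k, n < k → (jacobiPoly α β n).coeff k = 0 := fun n k hk =>
    coeff_eq_zero_of_natDegree_lt (by rwa [jacobiPoly_natDegree h.hα h.hs])
  have hPz : ∀ n k, n < k → (matJacobi α β v n).coeff k = 0 := fun n k hk =>
    coeff_eq_zero_of_natDegree_lt (by rwa [(h.isSimpleSeq n).1])
  have htop : ∀ n, (matJacobi α β v n).coeff n =
      !![((jacobiPoly α β n).coeff n : ℂ) * (n + a₁), 0;
        0, ((jacobiPoly α β n).coeff n : ℂ) * (n + a₂)] := by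
    intro n
    rw [matJacobi_coeff, hzero n (n + 1) (by omega), ha₁, ha₂]
    ext i j
    fin_cases i <;> fin_cases j <;> simp [matA]
  -- comparison of leading coefficients
  have hlead : ∀ n : ℕ, Λ n * (matJacobi α β v n).coeff n = (matJacobi α β v n).coeff n *
      Matrix.of fun i j => (T i j).eval (n : ℂ) := by
    intro n
    rw [← coeff_C_mul, ← hΛ, hD.coeff_act_top hdeg n (hPz n)]
    congr 1
    ext i j
    exact hT n i j
  -- `Y` extends `n ↦ y_n` to complex arguments, so that the relations can be evaluated at
  -- non-integers.
  set Y : ℂ[X] := X * (X + C ((α : ℂ) + β + 3)) with hY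
  have hYe : ∀ z : ℂ, Y.eval z = z * (z + (α + β + 3)) := fun z => by simp [hY]
  have hYn : ∀ n : ℕ, (jacobiEig α β n : ℂ) = Y.eval (n : ℂ) := fun n => by
    rw [hYe, jacobiEig]; push_cast; ring
  have h01 : ∀ n : ℕ, (R 0 1).eval (Y.eval (n : ℂ)) * (n + a₂) = (n + a₁) * (T 0 1).eval (n : ℂ) := by
    intro n
    have := congrFun (congrFun (hlead n) 0) 1
    rw [htop] at this
    simp [Matrix.mul_apply, Fin.sum_univ_two, hR, hYn] at this
    exact mul_left_cancel₀ (hρ n) (by linear_combination this)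
  have h10 : ∀ n : ℕ, (R 1 0).eval (Y.eval (n : ℂ)) * (n + a₁) = (n + a₂) * (T 1 0).eval (n : ℂ) := by
    intro n
    have := congrFun (congrFun (hlead n) 1) 0
    rw [htop] at this
    simp [Matrix.mul_apply, Fin.sum_univ_two, hR, hYn] at this
    exact mul_left_cancel₀ (hρ n) (by linear_combination this)
  have h11 : ∀ n : ℕ, (R 1 1).eval (Y.eval (n : ℂ)) = (T 1 1).eval (n : ℂ) := by
    intro n
    have hna : (n : ℂ) + a₂ ≠ 0 := by
      have : (n : ℝ) + (-v + 2 + α + β) / 2 ≠ 0 := by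
        have := n.cast_nonneg (α := ℝ)
        have := h.h4
        positivity
      rw [ha₂]
      exact_mod_cast this
    have := congrFun (congrFun (hlead n) 1) 1
    rw [htop] at this
    simp [Matrix.mul_apply, Fin.sum_univ_two, hR, hYn] at this
    exact mul_left_cancel₀ (mul_ne_zero (hρ n) hna) (by linear_combination this)
  -- The entry `(0, 1)` of the subleading coefficients, multiplied by the gap `y_{n+1} - y_n` to
  -- clear the denominator in the subleading coefficient of `p_{n+1}`.
  have hsub : ∀ n : ℕ, (2 * ((n : ℂ) + 1) + (α + β + 2)) * ((n + 1 + a₁) * (U 0 1).eval (n + 1 : ℂ))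
      + ((α - β) * (n + 1) * (n + a₁) + (2 * ((n : ℂ) + 1) + (α + β + 2)) * (n + 1) *
        ((β - α) / v)) * (T 0 1).eval (n : ℂ)
      + ((2 * ((n : ℂ) + 1) + (α + β + 2)) * (n + 1) * (1 + (β - α) / v)) * (T 1 1).eval (n : ℂ)
      = (R 0 0).eval (Y.eval (n + 1 : ℂ)) *
        ((2 * ((n : ℂ) + 1) + (α + β + 2)) * (n + 1) * (1 + (β - α) / v))
      + (R 0 1).eval (Y.eval (n + 1 : ℂ)) *
        ((α - β) * (n + 1) * (n + a₂) + (2 * ((n : ℂ) + 1) + (α + β + 2)) * (n + 1) *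
          ((α - β) / v)) := by
    intro n
    have e : Λ (n + 1) * (matJacobi α β v (n + 1)).coeff n =
        (matJacobi α β v (n + 1)).coeff (n + 1) *
          (Matrix.of fun i j => (U i j).eval ((n + 1 : ℕ) : ℂ)) +
        (matJacobi α β v (n + 1)).coeff n * Matrix.of fun i j => (T i j).eval (n : ℂ) := by
      rw [← coeff_C_mul, ← hΛ, hD.coeff_act_subtop hdeg n (hPz (n + 1))]
      congr 2
      · ext i j; exact hU n i j
      · ext i j; exact hT n i j
    have e01 := congrFun (congrFun e 0) 1
    have hs := congrArg (fun r : ℝ => (r : ℂ)) (jacobiPoly_subleading (β := β) h.hα h.hs n)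
    have hY1 := hYn (n + 1)
    rw [htop, matJacobi_coeff] at e01
    push_cast at hs hY1
    simp [Matrix.mul_apply, Fin.sum_univ_two, hR, hY1, matA, matB, Matrix.vecHead] at e01
    refine mul_left_cancel₀ (hρ (n + 1)) ?_
    rw [ha₁, ha₂] at *
    linear_combination (-(2 * ((n : ℂ) + 1) + (α + β + 2))) * e01 +
      ((n + (-v + 2 + α + β) / 2) * (R 0 1).eval (Y.eval (n + 1 : ℂ)) -
        (n + (v + 2 + α + β) / 2) * (T 0 1).eval (n : ℂ)) * hs
  -- passage from integers to complex numbers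
  have h01' : ∀ z : ℂ, (R 0 1).eval (Y.eval z) * (z + a₂) = (z + a₁) * (T 0 1).eval z := by
    intro z
    have := eq_of_eval_natCast_eq (p := (R 0 1).comp Y * (X + C a₂)) (q := (X + C a₁) * T 0 1)
      (fun n => by simpa [eval_comp] using h01 n)
    simpa [eval_comp] using congrArg (eval z) this
  have h10' : ∀ z : ℂ, (R 1 0).eval (Y.eval z) * (z + a₁) = (z + a₂) * (T 1 0).eval z := by
    intro z
    have := eq_of_eval_natCast_eq (p := (R 1 0).comp Y * (X + C a₁)) (q := (X + C a₂) * T 1 0)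
      (fun n => by simpa [eval_comp] using h10 n)
    simpa [eval_comp] using congrArg (eval z) this
  have h11' : ∀ z : ℂ, (R 1 1).eval (Y.eval z) = (T 1 1).eval z := by
    intro z
    rw [← eq_of_eval_natCast_eq (p := (R 1 1).comp Y) (q := T 1 1)
      (fun n => by simpa [eval_comp] using h11 n), eval_comp]
  have hsub' : ∀ z : ℂ, (2 * (z + 1) + (α + β + 2)) * ((z + 1 + a₁) * (U 0 1).eval (z + 1))
      + ((α - β) * (z + 1) * (z + a₁) + (2 * (z + 1) + (α + β + 2)) * (z + 1) *
        ((β - α) / v)) * (T 0 1).eval z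
      + ((2 * (z + 1) + (α + β + 2)) * (z + 1) * (1 + (β - α) / v)) * (T 1 1).eval z
      = (R 0 0).eval (Y.eval (z + 1)) *
        ((2 * (z + 1) + (α + β + 2)) * (z + 1) * (1 + (β - α) / v))
      + (R 0 1).eval (Y.eval (z + 1)) *
        ((α - β) * (z + 1) * (z + a₂) + (2 * (z + 1) + (α + β + 2)) * (z + 1) *
          ((α - β) / v)) := by
    intro z
    let e : ℂ[X] := C 2 * (X + C 1) + C ((α : ℂ) + β + 2)
    have := eq_of_eval_natCast_eq
      (p := e * ((X + C 1 + C a₁) * (U 0 1).comp (X + C 1)) +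
        (C ((α : ℂ) - β) * (X + C 1) * (X + C a₁) + e * (X + C 1) * C (((β : ℂ) - α) / v)) * T 0 1 +
        (e * (X + C 1) * C (1 + ((β : ℂ) - α) / v)) * T 1 1)
      (q := ((R 0 0).comp Y).comp (X + C 1) * (e * (X + C 1) * C (1 + ((β : ℂ) - α) / v)) +
        ((R 0 1).comp Y).comp (X + C 1) *
          (C ((α : ℂ) - β) * (X + C 1) * (X + C a₂) + e * (X + C 1) * C (((α : ℂ) - β) / v)))
      (fun n => by
        simp only [e, eval_add, eval_mul, eval_X, eval_C, eval_comp]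
        exact hsub n)
    have := congrArg (eval z) this
    simp only [e, eval_add, eval_mul, eval_X, eval_C, eval_comp] at this
    exact this
  have ha₁0 : a₁ ≠ 0 := by rw [ha₁]; exact div_ne_zero hx3 two_ne_zero
  have hav : a₁ - a₂ = v := by rw [ha₁, ha₂]; ring
  have hs : (α : ℂ) + β + 3 = a₁ + a₂ + 1 := by rw [ha₁, ha₂]; ring
  have hs' : (α : ℂ) + β + 2 = a₁ + a₂ := by rw [ha₁, ha₂]; ring
  -- The values are `-c₀`, `-c₁`, `-c₁`; the points `-a₂` and `-a₁ - 1` are exchanged by the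
  -- symmetry `z ↦ -(α + β + 3) - z` of `Y`.
  have y1 : Y.eval (-a₁) = -(a₁ * (a₂ + 1)) := by rw [hYe, hs]; ring
  have y2 : Y.eval (-a₂) = -(a₂ * (a₁ + 1)) := by rw [hYe, hs]; ring
  have y3 : Y.eval (-a₁ - 1) = -(a₂ * (a₁ + 1)) := by rw [hYe, hs]; ring
  have r01 : (R 0 1).eval (-(a₁ * (a₂ + 1))) = 0 := by
    have := h01' (-a₁)
    rw [y1, neg_add_cancel, zero_mul] at this
    refine (mul_eq_zero.1 this).resolve_right fun h0 => hv ?_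
    rw [← hav]; linear_combination -h0
  have r10 : (R 1 0).eval (-(a₂ * (a₁ + 1))) = 0 := by
    have := h10' (-a₂)
    rw [y2, neg_add_cancel, zero_mul] at this
    refine (mul_eq_zero.1 this).resolve_right fun h0 => hv ?_
    rw [← hav]; linear_combination h0
  -- At `z = -a₁ - 1` the factor of `U 0 1` and the coefficient of `T 0 1` vanish, and `R 0 1`
  -- vanishes by `r01`. What remains is `R 0 0 = T 1 1` up to the nonzero factor `a₁ (v + β - α)`.
  have rdiag : (R 0 0).eval (-(a₁ * (a₂ + 1))) = (R 1 1).eval (-(a₂ * (a₁ + 1))) := by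
    have e0 := hsub' (-a₁ - 1)
    rw [sub_add_cancel, y1, r01, hs'] at e0
    have et : (R 1 1).eval (-(a₂ * (a₁ + 1))) = (T 1 1).eval (-a₁ - 1) := by
      rw [← h11', y3]
    rw [et]
    have hne : (v : ℂ) + β - α ≠ 0 := fun h0 => hx2 (by linear_combination h0)
    have e1 : a₁ * (v + β - α) * ((R 0 0).eval (-(a₁ * (a₂ + 1))) -
        (T 1 1).eval (-a₁ - 1)) = 0 := by
      have hd : (2 : ℂ) * -a₁ + (a₁ + a₂) = -v := by rw [← hav]; ring
      rw [hd] at e0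
      field_simp at e0
      linear_combination -a₁ * e0
    exact sub_eq_zero.1 ((mul_eq_zero.1 e1).resolve_left (mul_ne_zero ha₁0 hne))
  have hdvd : ∀ (p : ℂ[X]) (c : ℂ), p.eval (-c) = 0 → ∃ q : ℂ[X], p = (X + C c) * q := by
    intro p c hp
    have : X - C (-c) ∣ p := dvd_iff_isRoot.2 hp
    rwa [C_neg, sub_neg_eq_add] at this
  obtain ⟨f00, h00⟩ := hdvd (R 0 0 - C ((R 0 0).eval (-(a₁ * (a₂ + 1))))) (a₁ * (a₂ + 1)) (by simp)
  obtain ⟨f01, h01⟩ := hdvd (R 0 1) (a₁ * (a₂ + 1)) r01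
  obtain ⟨f10, h10⟩ := hdvd (R 1 0) (a₂ * (a₁ + 1)) r10
  obtain ⟨f11, h11⟩ := hdvd (R 1 1 - C ((R 0 0).eval (-(a₁ * (a₂ + 1))))) (a₂ * (a₁ + 1))
    (by simp [rdiag])
  refine ⟨(R 0 0).eval (-(a₁ * (a₂ + 1))), ![![f00, f01], ![f10, f11]], fun n i j => ?_⟩
  have k00 := congrArg (eval (jacobiEig α β n : ℂ)) h00
  have k11 := congrArg (eval (jacobiEig α β n : ℂ)) h11
  rw [eval_sub, eval_C, eval_mul, eval_add, eval_X, eval_C] at k00 k11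
  rw [hR]
  fin_cases i <;> fin_cases j
  · simp [hc0]; linear_combination k00
  · simp [hc0, h01]
  · simp [hc1, h10]
  · simp [hc1]; linear_combination k11

end

/-! ### Calculus of eigenvalues, central operators, and generation. -/

/-- `D` is a differential operator with eigenvalues `Λ n` on the polynomials `matJacobi`. -/
def HasEigenvalues (α β v : ℝ) (D : RightOp 2) (Λ : ℕ → Matrix (Fin 2) (Fin 2) ℂ) : Prop :=
  IsMatDiffOp D ∧ ∀ n, RightOp.act (matJacobi α β v n) D = C (Λ n) * matJacobi α β v n

/-- The operator `𝒩 E_{ij} 𝒱`. -/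
noncomputable def opE (α β v : ℝ) (i j : Fin 2) : RightOp 2 :=
  opN α β v * dTerm 0 (constMat (Matrix.single i j 1)) * opV α β v

lemma opD_eq_opE (α β v : ℝ) : opD1 α β v = opE α β v 0 0 ∧ opD2 α β v = opE α β v 0 1 ∧
    opD3 α β v = opE α β v 1 0 ∧ opD4 α β v = opE α β v 1 1 := by
  refine ⟨?_, ?_, ?_, ?_⟩
  · rw [opD1, opE]; congr; ext i j; fin_cases i <;> fin_cases j <;> simp
  · rw [opD2, opE]; congr; ext i j; fin_cases i <;> fin_cases j <;> simp
  · rw [opD3, opE]; congr; ext i j; fin_cases i <;> fin_cases j <;> simp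
  · rw [opD4, opE]; congr; ext i j; fin_cases i <;> fin_cases j <;> simp

lemma jacobiGenerators_eq (α β v : ℝ) : jacobiGenerators α β v =
    {D | D = 1 ∨ ∃ i j, D = opE α β v i j ∨ D = opD5 α β v * opE α β v i j} := by
  obtain ⟨h1, h2, h3, h4⟩ := opD_eq_opE α β v
  rw [jacobiGenerators, h1, h2, h3, h4]
  generalize opE α β v = e
  generalize opD5 α β v = d
  refine Set.Subset.antisymm ?_ ?_
  · rintro D (h | h | h | h | h | h | h | h | h)
    exacts [Or.inl h, Or.inr ⟨0, 0, Or.inl h⟩, Or.inr ⟨0, 1, Or.inl h⟩, Or.inr ⟨1, 0, Or.inl h⟩,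
      Or.inr ⟨1, 1, Or.inl h⟩, Or.inr ⟨0, 0, Or.inr h⟩, Or.inr ⟨0, 1, Or.inr h⟩,
      Or.inr ⟨1, 0, Or.inr h⟩, Or.inr ⟨1, 1, Or.inr h⟩]
  · rintro D (rfl | ⟨i, j, hD⟩)
    · exact Or.inl rfl
    · obtain rfl | rfl : i = 0 ∨ i = 1 := by omega
      all_goals
        obtain rfl | rfl : j = 0 ∨ j = 1 := by omega
        all_goals
          obtain rfl | rfl := hD <;>
            simp only [Set.mem_insert_iff, Set.mem_singleton_iff, true_or, or_true]

section
variable {α β v : ℝ} {D E : RightOp 2} {Λ M : ℕ → Matrix (Fin 2) (Fin 2) ℂ}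

lemma HasEigenvalues.congr (hD : HasEigenvalues α β v D Λ) (h : ∀ n, Λ n = M n) :
    HasEigenvalues α β v D M := (funext h : Λ = M) ▸ hD

lemma HasEigenvalues.add (hD : HasEigenvalues α β v D Λ) (hE : HasEigenvalues α β v E M) :
    HasEigenvalues α β v (D + E) (Λ + M) :=
  ⟨hD.1.add hE.1, fun n => by
    rw [act_add, hD.2, hE.2, ← add_mul, ← C_add, Pi.add_apply]⟩

lemma HasEigenvalues.mul (hD : HasEigenvalues α β v D Λ) (hE : HasEigenvalues α β v E M) :
    HasEigenvalues α β v (D * E) (Λ * M) :=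
  ⟨hD.1.mul hE.1, fun n => by
    rw [act_mul, hD.2, hE.1.act_C_mul, hE.2, ← mul_assoc, ← C_mul, Pi.mul_apply]⟩

lemma hasEigenvalues_algebraMap (c : ℂ) :
    HasEigenvalues α β v (algebraMap ℂ (RightOp 2) c) fun _ => algebraMap ℂ _ c :=
  ⟨algebraMap_eq_dTerm (N := 2) c ▸ dTerm_isMatDiffOp _ _, fun n => by
    rw [algebraMap_eq_dTerm, dTerm_act, Function.iterate_zero, id, ← Algebra.commutes]; rfl⟩

lemma HasEigenvalues.smul (c : ℂ) (hD : HasEigenvalues α β v D Λ) :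
    HasEigenvalues α β v (c • D) (c • Λ) := by
  have := (hasEigenvalues_algebraMap (α := α) (β := β) (v := v) c).mul hD
  rw [← Algebra.smul_def] at this
  refine this.congr fun n => ?_
  rw [Pi.mul_apply, ← Algebra.smul_def, Pi.smul_apply]

lemma HasEigenvalues.mem (h : JacobiParams α β v) (hD : HasEigenvalues α β v D Λ) :
    D ∈ jacobiAlg α β v := h.mem_jacobiAlg_iff.2 ⟨hD.1, Λ, hD.2⟩

lemma HasEigenvalues.ext (h : JacobiParams α β v) (hD : HasEigenvalues α β v D Λ)
    (hE : HasEigenvalues α β v E Λ) : D = E :=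
  h.isSimpleSeq.op_ext hD.1 hE.1 fun n => by rw [hD.2, hE.2]

lemma JacobiParams.hasEigenvalues_opE (h : JacobiParams α β v) (i j : Fin 2) :
    HasEigenvalues α β v (opE α β v i j) fun n =>
      Matrix.single i j (-((jacobiEig α β n : ℂ) + eigShift α β v i)) := by
  refine ⟨((opN_isMatDiffOp α β v).mul (dTerm_isMatDiffOp _ _)).mul (opV_isMatDiffOp α β v),
    fun n => ?_⟩
  rw [opE, h.act_opN_mul_opV]
  congr 2
  ext k l
  rw [Matrix.neg_mul, Matrix.neg_apply, Matrix.diagonal_mul, Matrix.map_apply]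
  beta_reduce
  by_cases hk : i = k ∧ j = l
  · obtain ⟨rfl, rfl⟩ := hk; simp
  · rw [Matrix.single_apply_of_ne _ _ _ _ _ hk, Matrix.single_apply_of_ne _ _ _ _ _ hk]; simp

lemma JacobiParams.hasEigenvalues_opD5_mul (h : JacobiParams α β v) (i j : Fin 2) :
    HasEigenvalues α β v (opD5 α β v * opE α β v i j) fun n =>
      Matrix.single i j (((jacobiEig α β n : ℂ) + eigShift α β v i) ^ 2) := by
  obtain ⟨h1, h2, h3, h4⟩ := opD_eq_opE α β v
  rw [opD5, h1, h4]
  refine (((h.hasEigenvalues_opE 0 0).add (h.hasEigenvalues_opE 1 1)).mul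
    (h.hasEigenvalues_opE i j)).congr fun n => ?_
  rw [Pi.mul_apply, Pi.add_apply, add_mul]
  obtain rfl | rfl : i = 0 ∨ i = 1 := by omega
  · rw [Matrix.single_mul_single_same, Matrix.single_mul_single_of_ne _ _ _ _ (by decide), add_zero]
    congr 1; ring
  · rw [Matrix.single_mul_single_of_ne _ _ _ _ (by decide), zero_add,
      Matrix.single_mul_single_same]
    congr 1; ring

/-- `𝒟(W)` contains the operators `𝒩 F 𝒱` for all matrix polynomials `F` in the Jacobi operator. -/
lemma JacobiParams.exists_hasEigenvalues_single (h : JacobiParams α β v) (i j : Fin 2) (f : ℂ[X]) :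
    ∃ D, HasEigenvalues α β v D fun n => Matrix.single i j
      (((jacobiEig α β n : ℂ) + eigShift α β v i) * f.eval (jacobiEig α β n : ℂ)) := by
  induction f using Polynomial.induction_on with
  | C a =>
    refine ⟨_, ((h.hasEigenvalues_opE i j).smul (-a)).congr fun n => ?_⟩
    rw [Pi.smul_apply, Matrix.smul_single, eval_C, smul_eq_mul]
    congr 1; ring
  | add p q hp hq =>
    obtain ⟨D, hD⟩ := hp
    obtain ⟨E, hE⟩ := hq
    refine ⟨_, (hD.add hE).congr fun n => ?_⟩
    rw [Pi.add_apply, ← Matrix.single_add, eval_add, mul_add]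
  | monomial m a hm =>
    obtain ⟨D, hD⟩ := hm
    -- Right multiplication by `𝒩 E_jj 𝒱` contributes `-(y + c_j)`; changing sign and subtracting
    -- `c_j` leaves multiplication by `y`.
    refine ⟨_, (((hD.mul (h.hasEigenvalues_opE j j)).smul (-1)).add
      (hD.smul (-(eigShift α β v j : ℂ)))).congr fun n => ?_⟩
    rw [Pi.add_apply, Pi.smul_apply, Pi.smul_apply, Pi.mul_apply, Matrix.single_mul_single_same,
      Matrix.smul_single, Matrix.smul_single, ← Matrix.single_add, pow_succ, ← mul_assoc,
      eval_mul (q := X), eval_X, smul_eq_mul, smul_eq_mul]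
    congr 1; ring

/-- Central elements of `𝒟(W)`. -/
lemma JacobiParams.exists_central (h : JacobiParams α β v) (g : ℂ[X]) :
    ∃ z : Subalgebra.center ℂ (jacobiAlg α β v), HasEigenvalues α β v (z : jacobiAlg α β v)
      fun n => algebraMap ℂ _ (((jacobiEig α β n : ℂ) + eigShift α β v 0) *
        ((jacobiEig α β n : ℂ) + eigShift α β v 1) * g.eval (jacobiEig α β n : ℂ)) := by
  -- Each diagonal entry receives the other entry's linear factor, so the two agree. The eigenvalue
  -- is then scalar and commutes with every other.
  obtain ⟨D, hD⟩ := h.exists_hasEigenvalues_single 0 0 ((X + C (eigShift α β v 1 : ℂ)) * g)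
  obtain ⟨E, hE⟩ := h.exists_hasEigenvalues_single 1 1 ((X + C (eigShift α β v 0 : ℂ)) * g)
  have hz : HasEigenvalues α β v (D + E) fun n => algebraMap ℂ _
      (((jacobiEig α β n : ℂ) + eigShift α β v 0) *
        ((jacobiEig α β n : ℂ) + eigShift α β v 1) * g.eval (jacobiEig α β n : ℂ)) := by
    refine (hD.add hE).congr fun n => ?_
    ext i j
    fin_cases i <;> fin_cases j <;> simp [Matrix.algebraMap_matrix_apply] <;> ring
  refine ⟨⟨⟨D + E, hz.mem h⟩, Subalgebra.mem_center_iff.2 ?_⟩, hz⟩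
  rintro ⟨B, hB⟩
  obtain ⟨hB', M, hM⟩ := h.mem_jacobiAlg_iff.1 hB
  refine Subtype.ext ?_
  have hBM : HasEigenvalues α β v B M := ⟨hB', hM⟩
  exact (hBM.mul hz).ext h ((hz.mul hBM).congr fun n => Algebra.commutes _ (M n))

lemma Polynomial.exists_eq_quadratic_mul_add (f : ℂ[X]) (c₀ c₁ c : ℂ) :
    ∃ (g : ℂ[X]) (a b : ℂ), f = (X + C c₀) * (X + C c₁) * g + C a + C b * (X + C c) := by
  have hdiv : ∀ (p : ℂ[X]) (c : ℂ), ∃ q, p = (X + C c) * q + C (p.eval (-c)) := by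
    intro p c
    obtain ⟨q, hq⟩ := X_sub_C_dvd_sub_C_eval (a := -c) (p := p)
    exact ⟨q, by rw [C_neg, sub_neg_eq_add] at hq; rw [← hq]; ring⟩
  obtain ⟨q, hq⟩ := hdiv f c₀
  obtain ⟨g, hg⟩ := hdiv q c₁
  -- The remainder of the two divisions is rewritten with `X + c₀ = (X + c) + (c₀ - c)`.
  refine ⟨g, f.eval (-c₀) + q.eval (-c₁) * (c₀ - c), q.eval (-c₁), ?_⟩
  rw [C_add, C_mul, C_sub]
  linear_combination hq + (X + C c₀) * hg

end

theorem mainTheorem12 (α β v : ℝ) (hv₁ : |α - β| < |v|) (hv₂ : |v| < α + β + 2) :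
    jacobiGenerators α β v ⊆ (jacobiAlg α β v : Set (RightOp 2)) ∧
      Submodule.span (Subalgebra.center ℂ (jacobiAlg α β v))
        ((↑) ⁻¹' jacobiGenerators α β v : Set (jacobiAlg α β v)) = ⊤ := by
  have h := JacobiParams.mk' hv₁ hv₂
  have hsub : jacobiGenerators α β v ⊆ (jacobiAlg α β v : Set (RightOp 2)) := by
    rw [jacobiGenerators_eq]
    rintro D (rfl | ⟨i, j, rfl | rfl⟩)
    · exact one_mem _
    · exact (h.hasEigenvalues_opE i j).mem h
    · exact (h.hasEigenvalues_opD5_mul i j).mem h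
  refine ⟨hsub, ?_⟩
  rw [eq_top_iff]
  rintro ⟨D, hD⟩ -
  obtain ⟨hD', Λ, hΛ⟩ := h.mem_jacobiAlg_iff.1 hD
  obtain ⟨c, f, hf⟩ := h.eigenvalue_structure hD' hΛ
  have hdec : ∀ i j, ∃ (g : ℂ[X]) (a b : ℂ), f i j = (X + C (eigShift α β v 0 : ℂ)) *
      (X + C (eigShift α β v 1 : ℂ)) * g + C a + C b * (X + C (eigShift α β v i : ℂ)) :=
    fun i j => exists_eq_quadratic_mul_add _ _ _ _
  choose g a b hgab using hdec
  choose z hz using h.exists_central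
  set S := Submodule.span (Subalgebra.center ℂ (jacobiAlg α β v))
    ((↑) ⁻¹' jacobiGenerators α β v : Set (jacobiAlg α β v))
  have hgen : ∀ B (hB : B ∈ jacobiGenerators α β v), (⟨B, hsub hB⟩ : jacobiAlg α β v) ∈ S :=
    fun B hB => Submodule.subset_span hB
  -- Complex scalars act through the center.
  have hsc : ∀ (k : ℂ) (x : jacobiAlg α β v), x ∈ S → k • x ∈ S := by
    intro k x hx
    have := S.smul_mem (algebraMap ℂ (Subalgebra.center ℂ (jacobiAlg α β v)) k) hx
    rwa [algebraMap_smul] at this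
  have hE : ∀ i j, opE α β v i j ∈ jacobiGenerators α β v := fun i j => by
    rw [jacobiGenerators_eq]; exact Or.inr ⟨i, j, Or.inl rfl⟩
  have h5 : ∀ i j, opD5 α β v * opE α β v i j ∈ jacobiGenerators α β v := fun i j => by
    rw [jacobiGenerators_eq]; exact Or.inr ⟨i, j, Or.inr rfl⟩
  have h1 : (1 : RightOp 2) ∈ jacobiGenerators α β v := by
    rw [jacobiGenerators_eq]; exact Or.inl rfl
  -- The signs reflect that `𝒩 E_ij 𝒱` has eigenvalue `-(y + c_i) E_ij`, while `D₅ 𝒩 E_ij 𝒱` has `(y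
  -- + c_i)² E_ij`. Expanding the remainder around `c_i` in `hdec` makes `a` and `b` the
  -- coefficients needed.
  let t : Fin 2 → Fin 2 → jacobiAlg α β v := fun i j =>
    (-1 : ℂ) • (z (g i j) • ⟨_, hsub (hE i j)⟩) + (-a i j) • ⟨_, hsub (hE i j)⟩ +
      b i j • ⟨_, hsub (h5 i j)⟩
  have htS : ∀ i j, t i j ∈ S := fun i j => S.add_mem (S.add_mem
    (hsc _ _ (S.smul_mem _ (hgen _ (hE i j)))) (hsc _ _ (hgen _ (hE i j)))) (hsc _ _ (hgen _ (h5 i j)))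
  have hte : ∀ i j, HasEigenvalues α β v (t i j) fun n => Matrix.single i j
      (((jacobiEig α β n : ℂ) + eigShift α β v i) * (f i j).eval (jacobiEig α β n : ℂ)) := by
    intro i j
    refine HasEigenvalues.congr (((((hz (g i j)).mul (h.hasEigenvalues_opE i j)).smul (-1)).add
      ((h.hasEigenvalues_opE i j).smul (-a i j))).add
      ((h.hasEigenvalues_opD5_mul i j).smul (b i j))) fun n => ?_
    rw [Pi.add_apply, Pi.add_apply, Pi.smul_apply, Pi.smul_apply, Pi.smul_apply, Pi.mul_apply,
      ← Algebra.smul_def, Matrix.smul_single, Matrix.smul_single, Matrix.smul_single,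
      Matrix.smul_single, ← Matrix.single_add, ← Matrix.single_add, hgab]
    congr 1
    simp only [eval_add, eval_mul, eval_X, eval_C, smul_eq_mul]
    ring
  have hfin : (⟨D, hD⟩ : jacobiAlg α β v) =
      c • ⟨1, hsub h1⟩ + (t 0 0 + t 0 1 + (t 1 0 + t 1 1)) := by
    refine Subtype.ext ?_
    refine HasEigenvalues.ext h (Λ := Λ) ⟨hD', hΛ⟩ ?_
    have h1e : HasEigenvalues α β v (c • (1 : RightOp 2)) fun _ => algebraMap ℂ _ c := by
      rw [← Algebra.algebraMap_eq_smul_one]; exact hasEigenvalues_algebraMap c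
    refine (h1e.add (((hte 0 0).add (hte 0 1)).add ((hte 1 0).add (hte 1 1)))).congr fun n => ?_
    ext i j
    rw [hf]
    fin_cases i <;> fin_cases j <;> simp [Matrix.algebraMap_matrix_apply]
  rw [hfin]
  exact S.add_mem (hsc _ _ (hgen _ h1)) (S.add_mem (S.add_mem (htS 0 0) (htS 0 1))
    (S.add_mem (htS 1 0) (htS 1 1)))
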